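/- Let $A=\mathbb F_q[T]$, $F=\mathbb F_q(T)$, let $\mathfrak p=(\pi)$ be a nonzero prime ideal of $A$, let $K=F_{\mathfrak p}$ be the completion of $F$ at $\mathfrak p$, $\mathcal O=A_{\mathfrak p}$ its ring of integers with maximal ideal $\mathfrak m$, and $\mathbf C_{\mathfrak p}$ the completion of an algebraic closure of $K$. Write $\mathcal O\{\tau\}$ for the ring of skew polynomials with $\tau c=c^q\tau$; the operator $\sum_i c_i\tau^i$ is also regarded as the polynomial $\sum_i c_ix^{q^i}$. Let $\Phi:A\to\mathcal O\{\tau\}$, $a\mapsto\Phi_a$, be a Drinfeld module of rank $r>1$, that is, a ring homomorphism such that $\Phi_a$ has constant coefficient $a$ and, for $a\neq0$, degree $r\deg a$ in $\tau$. Assume that $\Phi$ has good reduction (its reduction modulo $\mathfrak m$ is a Drinfeld module of the same rank $r$), that the height of the reduction is maximal, i.e. equal to $r$ (the lowest power of $\tau$ occurring in $\Phi_\pi \bmod \mathfrak m$ is $\tau^{r\deg\pi}$), and that the polynomial $\Phi_\pi(x)$ is monic. Let $\Phi[\mathfrak p]\subset\mathbf C_{\mathfrak p}$ be the set of common zeros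 of all $\Phi_a$, $a\in\mathfrak p$. For a subring $R\subseteq\mathbf C_{\mathfrak p}$ let $R((x))_1$ be the ring of formal Laurent series over $R$ (with finite principal part) that converge on the punctured open unit ball $\{0<|z|<1\}$ of $\mathbf C_{\mathfrak p}$, with the topology given by the seminorms $\|f\|_\rho=\sup\{|f(z)|:|z|=\rho\}$ for $\rho\in|\mathbf C_{\mathfrak p}|\cap(0,1)$, and let $R((x))_1^*$ be its group of units. Theorem. There exists a continuous group homomorphism $\mathcal N:K((x))_1^*\to K((x))_1^*$ such that $$\prod_{u\in\Phi[\mathfrak p]}g(x+u)=(\mathcal N g)\circ\Phi_\pi\qquad\text{for all }g\in K((x))_1^*,$$ as functions on $\{z\in\mathbf C_{\mathfrak p}:|z|<1,\ z\notin\Phi[\mathfrak p]\}$. Moreover, $\mathcal N$ maps $\mathcal O((x))_1^*$ into itself, and on $\mathcal O((x))_1^*$ the iterates $\mathcal N^k$ converge, pointwise and locally uniformly, as $k\to\infty$ to a continuous group endomorphism $\mathcal N^\infty$ of $\mathcal O((x))_1^*$. -/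

import Mathlib

open Polynomial IsDedekindDomain Filter Topology
open scoped NNReal

noncomputable section

namespace DrinfeldColeman

section Fields

variable {k : Type*} [Field k] [Fintype k] (v : HeightOneSpectrum k[X])

/-- The local field `K = F_𝔭`: the completion of `F = 𝔽_q(T)` at the prime `𝔭` of `A = 𝔽_q[T]`. -/
abbrev LocalField : Type _ := v.adicCompletion (RatFunc k)

/-- The ring of integers `𝒪 = A_𝔭` of `K = F_𝔭`. -/
abbrev LocalInt : Type _ := v.adicCompletionIntegers (RatFunc k)

theorem one_lt_card : (1 : ℝ≥0) < (Fintype.card k : ℝ≥0) := by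
  exact_mod_cast Fintype.one_lt_card

instance rankOne : (Valued.v : Valuation (LocalField v) (WithZero (Multiplicative ℤ))).RankOne :=
  Valuation.IsRankOneDiscrete.rankOne
    (Valued.v : Valuation (LocalField v) (WithZero (Multiplicative ℤ))) (one_lt_card (k := k))

/-- The absolute value on `K = F_𝔭` belonging to the `𝔭`-adic valuation (with base `q`). -/
instance normedFieldLocal : NormedField (LocalField v) :=
  Valued.toNormedField (LocalField v) (WithZero (Multiplicative ℤ))

instance nontriviallyNormedFieldLocal : NontriviallyNormedField (LocalField v) where
  non_trivial := by
    obtain ⟨x, hx⟩ := HeightOneSpectrum.valuedAdicCompletion_surjective (RatFunc k) v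
      (WithZero.exp (1 : ℤ))
    refine ⟨x, ?_⟩
    rw [Valued.toNormedField.one_lt_norm_iff, hx, ← WithZero.exp_zero, WithZero.exp_lt_exp]
    norm_num

instance isUltrametricDistLocal : IsUltrametricDist (LocalField v) :=
  IsUltrametricDist.isUltrametricDist_of_forall_norm_add_le_max_norm
    (Valued.isNonarchimedean_norm (LocalField v) (WithZero (Multiplicative ℤ)))

/-- An algebraic closure of `K`. -/
abbrev LocalAlgCl : Type _ := AlgebraicClosure (LocalField v)

/-- The algebraic closure of `K` with the unique extension of the absolute value of `K`. -/
instance normedFieldAlgCl : NormedField (LocalAlgCl v) :=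
  spectralNorm.normedField (LocalField v) (LocalAlgCl v)

instance normedAlgebraAlgCl : NormedAlgebra (LocalField v) (LocalAlgCl v) :=
  spectralNorm.normedAlgebra _ _

/-- `𝐂_𝔭`: the completion of the algebraic closure of `K = F_𝔭`. -/
abbrev Cp : Type _ := UniformSpace.Completion (LocalAlgCl v)

theorem norm_add_le_max_algCl (x y : LocalAlgCl v) : ‖x + y‖ ≤ max ‖x‖ ‖y‖ :=
  isNonarchimedean_spectralNorm (K := LocalField v) (L := LocalAlgCl v) x y

instance isUltrametricDistAlgCl : IsUltrametricDist (LocalAlgCl v) :=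
  IsUltrametricDist.isUltrametricDist_of_forall_norm_add_le_max_norm (norm_add_le_max_algCl v)

instance isUltrametricDistCp : IsUltrametricDist (Cp v) := by
  refine IsUltrametricDist.isUltrametricDist_of_forall_norm_add_le_max_norm fun x y => ?_
  induction x, y using UniformSpace.Completion.induction_on₂ with
  | hp =>
    exact isClosed_le (continuous_norm.comp (continuous_fst.add continuous_snd))
      ((continuous_norm.comp continuous_fst).max (continuous_norm.comp continuous_snd))
  | ih a b =>
    rw [← UniformSpace.Completion.coe_add]
    simpa only [UniformSpace.Completion.norm_coe] using norm_add_le_max_algCl v a b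

instance nonarchimedeanRingCp : NonarchimedeanRing (Cp v) where
  is_nonarchimedean := NonarchimedeanAddGroup.is_nonarchimedean

/-- The embedding of `K` in `𝐂_𝔭`. -/
def embField : LocalField v →+* Cp v :=
  (algebraMap (LocalAlgCl v) (Cp v)).comp (algebraMap (LocalField v) (LocalAlgCl v))

/-- The embedding of `𝒪` in `𝐂_𝔭`. -/
def embInt : LocalInt v →+* Cp v :=
  (embField v).comp (v.adicCompletionIntegers (RatFunc k)).subtype

/-- `K` as a subring of `𝐂_𝔭`. -/
def subK : Subring (Cp v) := (embField v).range

/-- `𝒪` as a subring of `𝐂_𝔭`. -/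
def subO : Subring (Cp v) := (embInt v).range

theorem subO_le_subK : subO v ≤ subK v := by
  rintro _ ⟨a, rfl⟩
  exact ⟨a, rfl⟩

end Fields

section Drinfeld

variable {k : Type*} [Field k] [Fintype k] (v : HeightOneSpectrum k[X])

instance algebraConst : Algebra k (LocalInt v) :=
  ((algebraMap k[X] (LocalInt v)).comp (Polynomial.C : k →+* k[X])).toAlgebra

theorem add_pow_card_pow (n : ℕ) (x y : LocalInt v) :
    (x + y) ^ Fintype.card k ^ n = x ^ Fintype.card k ^ n + y ^ Fintype.card k ^ n := by
  induction n with
  | zero => simp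
  | succ n ih =>
    rw [pow_succ, pow_mul, pow_mul, pow_mul, ih]
    exact map_add (FiniteField.frobeniusAlgHom k (LocalInt v)) _ _

/-- The action of the powers of `τ` on `𝒪`: `τⁿ` acts by `x ↦ x ^ (qⁿ)`. With this action
`SkewPolynomial (LocalInt v)` is the ring `𝒪{τ}`, in which `τ c = c ^ q τ`. -/
instance frobeniusAction : MulSemiringAction (Multiplicative ℕ) (LocalInt v) where
  smul n x := x ^ Fintype.card k ^ n.toAdd
  one_smul x := by
    change x ^ Fintype.card k ^ 0 = x
    simp
  mul_smul m n x := by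
    change x ^ Fintype.card k ^ (m.toAdd + n.toAdd) =
      (x ^ Fintype.card k ^ n.toAdd) ^ Fintype.card k ^ m.toAdd
    rw [← pow_mul, add_comm, pow_add]
  smul_zero n := zero_pow (pow_ne_zero _ Fintype.card_ne_zero)
  smul_add n x y := add_pow_card_pow v n.toAdd x y
  smul_one n := one_pow _
  smul_mul n x y := mul_pow x y _

/-- The polynomial `∑ cᵢ x ^ (qⁱ)` over `𝒪` belonging to the operator `∑ cᵢ τⁱ`. -/
def toPoly {v : HeightOneSpectrum k[X]} (P : SkewPolynomial (LocalInt v)) : (LocalInt v)[X] :=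
  P.sum fun i c => Polynomial.monomial (Fintype.card k ^ i) c

/-- A Drinfeld `A`-module over `𝒪`, where `A = 𝔽_q[T]`: a ring homomorphism `A → 𝒪{τ}`,
`a ↦ Φ_a`, such that the constant coefficient of `Φ_a` is `a`. Its rank is specified by
`DrinfeldModule.HasRank` below. -/
structure DrinfeldModule where
  /-- the homomorphism `a ↦ Φ_a` -/
  toRingHom : k[X] →+* SkewPolynomial (LocalInt v)
  coeff_zero : ∀ a : k[X], (toRingHom a).coeff 0 = algebraMap k[X] (LocalInt v) a

namespace DrinfeldModule

variable {v}
variable (Φ : DrinfeldModule v)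

/-- The `i`-th coefficient of `Φ_a`. -/
def coeff (a : k[X]) (i : ℕ) : LocalInt v := (Φ.toRingHom a).coeff i

/-- The `i`-th coefficient of the reduction of `Φ_a` modulo the maximal ideal of `𝒪`. -/
def redCoeff (a : k[X]) (i : ℕ) : IsLocalRing.ResidueField (LocalInt v) :=
  IsLocalRing.residue (LocalInt v) (Φ.coeff a i)

/-- `Φ` has rank `r`: `Φ_a` has degree `r * deg a` in `τ` for every nonzero `a`. -/
def HasRank (r : ℕ) : Prop :=
  ∀ a : k[X], a ≠ 0 →
    Φ.coeff a (r * a.natDegree) ≠ 0 ∧ ∀ i, r * a.natDegree < i → Φ.coeff a i = 0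

/-- The reduction of `Φ` modulo the maximal ideal has rank `r`. -/
def HasReducedRank (r : ℕ) : Prop :=
  ∀ a : k[X], a ≠ 0 →
    Φ.redCoeff a (r * a.natDegree) ≠ 0 ∧ ∀ i, r * a.natDegree < i → Φ.redCoeff a i = 0

/-- `Φ` has good reduction: its reduction is a Drinfeld module of the same rank. -/
def HasGoodReduction : Prop := ∃ r, Φ.HasRank r ∧ Φ.HasReducedRank r

/-- The reduction of `Φ` has height `h`, where `π` generates `𝔭`: the lowest power of `τ` that
occurs in the reduction of `Φ_π` is the one with exponent `h * deg 𝔭`. -/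
def HasHeight (π : k[X]) (h : ℕ) : Prop :=
  Φ.redCoeff π (h * π.natDegree) ≠ 0 ∧ ∀ i, i < h * π.natDegree → Φ.redCoeff π i = 0

/-- The polynomial `Φ_a(x)`. -/
def poly (a : k[X]) : (LocalInt v)[X] := toPoly (Φ.toRingHom a)

/-- The value `Φ_a(z)` for `z ∈ 𝐂_𝔭`. -/
def eval (a : k[X]) (z : Cp v) : Cp v := (Φ.poly a).eval₂ (embInt v) z

/-- The `𝔭`-torsion `Φ[𝔭]`: the common zeros in `𝐂_𝔭` of all `Φ_a`, `a ∈ 𝔭`. -/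
def torsion : Set (Cp v) := {u | ∀ a ∈ v.asIdeal, Φ.eval a u = 0}

end DrinfeldModule

end Drinfeld

section Laurent

variable {k : Type*} [Field k] [Fintype k] {v : HeightOneSpectrum k[X]}

/-- The formal Laurent series `f` converges on the punctured open unit ball `B'` of `𝐂_𝔭`. -/
def ConvergesOnBall (f : LaurentSeries (Cp v)) : Prop :=
  ∀ z : Cp v, 0 < ‖z‖ → ‖z‖ < 1 → Summable fun n : ℤ => f.coeff n * z ^ n

theorem ConvergesOnBall.mul {f g : LaurentSeries (Cp v)} (hf : ConvergesOnBall f)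
    (hg : ConvergesOnBall g) : ConvergesOnBall (f * g) := by
  intro z hz hz1
  have h0 : z ≠ 0 := norm_pos_iff.mp hz
  have h := (hf z hz hz1).mul_of_nonarchimedean (hg z hz hz1)
  have h2 := ((Equiv.sigmaFiberEquiv (fun p : ℤ × ℤ => p.1 + p.2)).summable_iff.mpr h).sigma
  refine h2.congr fun n => ?_
  have key : HasSum (fun p : {p : ℤ × ℤ // p.1 + p.2 = n} =>
      f.coeff p.1.1 * z ^ p.1.1 * (g.coeff p.1.2 * z ^ p.1.2)) ((f * g).coeff n * z ^ n) := by
    rw [HahnSeries.coeff_mul, Finset.sum_mul]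
    let e : {p : ℤ × ℤ // p.1 + p.2 = n} → ℤ × ℤ := Subtype.val
    let F : ℤ × ℤ → Cp v := fun p => f.coeff p.1 * z ^ p.1 * (g.coeff p.2 * z ^ p.2)
    let s := Finset.antidiagonal f.isPWO_support g.isPWO_support n
    have hsum : HasSum (Set.indicator {p : ℤ × ℤ | p.1 + p.2 = n} F) (∑ p ∈ s, F p) := by
      have : ∑ p ∈ s, F p = ∑ p ∈ s, Set.indicator {p : ℤ × ℤ | p.1 + p.2 = n} F p := by
        refine Finset.sum_congr rfl fun p hp => ?_
        rw [Set.indicator_of_mem]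
        exact (Finset.mem_antidiagonal.mp hp).2.2
      rw [this]
      refine hasSum_sum_of_ne_finset_zero fun p hp => ?_
      by_cases hn : p.1 + p.2 = n
      · rw [Set.indicator_of_mem (by exact hn)]
        by_contra hne
        apply hp
        refine Finset.mem_antidiagonal.mpr ⟨?_, ?_, hn⟩
        · intro h; apply hne; simp [F, h]
        · intro h; apply hne; simp [F, h]
      · exact Set.indicator_of_notMem (by exact hn) _
    have hval : ∑ p ∈ s, F p = ∑ p ∈ s, f.coeff p.1 * g.coeff p.2 * z ^ n := by
      refine Finset.sum_congr rfl fun p hp => ?_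
      have hn : p.1 + p.2 = n := (Finset.mem_antidiagonal.mp hp).2.2
      simp only [F]
      rw [← hn, zpow_add₀ h0]
      ring
    rw [← hval]
    exact (hasSum_subtype_iff_indicator (s := {p : ℤ × ℤ | p.1 + p.2 = n})).mpr hsum
  exact key.tsum_eq.symm ▸ rfl

/-- `R((x))₁` for a subring `R` of `𝐂_𝔭`: the ring of formal Laurent series with coefficients in
`R` that converge on the punctured open unit ball of `𝐂_𝔭`. -/
def convergentLaurentSubring (R : Subring (Cp v)) : Subring (LaurentSeries (Cp v)) where
  carrier := {f | (∀ n, f.coeff n ∈ R) ∧ ConvergesOnBall f}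
  zero_mem' := ⟨fun n => by simp, fun z _ _ => by simp⟩
  one_mem' := by
    refine ⟨fun n => ?_, fun z _ _ => ?_⟩
    · rw [HahnSeries.coeff_one]
      split_ifs
      exacts [R.one_mem, R.zero_mem]
    · refine summable_of_ne_finset_zero (s := {0}) fun n hn => ?_
      rw [HahnSeries.coeff_one, if_neg (by simpa using hn), zero_mul]
  add_mem' := fun {f g} hf hg =>
    ⟨fun n => by simpa using R.add_mem (hf.1 n) (hg.1 n), fun z h0 h1 => by
      simpa [add_mul] using (hf.2 z h0 h1).add (hg.2 z h0 h1)⟩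
  neg_mem' := fun {f} hf =>
    ⟨fun n => by simpa using R.neg_mem (hf.1 n), fun z h0 h1 => by
      simpa using (hf.2 z h0 h1).neg⟩
  mul_mem' := fun {f g} hf hg =>
    ⟨fun n => by
      rw [HahnSeries.coeff_mul]
      exact R.sum_mem fun p _ => R.mul_mem (hf.1 _) (hg.1 _), hf.2.mul hg.2⟩

/-- The ring `R((x))₁` as a type of its own, so that it carries only the topology given below. -/
def ConvergentLaurent (R : Subring (Cp v)) : Type _ := convergentLaurentSubring R

instance (R : Subring (Cp v)) : CommRing (ConvergentLaurent R) :=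
  inferInstanceAs (CommRing (convergentLaurentSubring R))

/-- The value `f(z)`. -/
def ConvergentLaurent.eval {R : Subring (Cp v)} (f : ConvergentLaurent R) (z : Cp v) : Cp v :=
  ∑' n : ℤ, f.1.coeff n * z ^ n

/-- The punctured open unit ball `B'` of `𝐂_𝔭`. -/
abbrev PuncturedBall (v : HeightOneSpectrum k[X]) : Type _ := {z : Cp v // 0 < ‖z‖ ∧ ‖z‖ < 1}

/-- The circles `{z : |z| = ρ}` in the punctured open unit ball. -/
def circles (v : HeightOneSpectrum k[X]) : Set (Set (PuncturedBall v)) :=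
  {S | ∃ ρ : ℝ, S = {z | ‖z.1‖ = ρ}}

/-- The uniform structure on `R((x))₁` (and with it the topology) induced by the seminorms
`‖f‖_ρ = sup {|f(z)| : |z| = ρ}`, `0 < ρ < 1`, that is, the structure of uniform convergence on
each circle `|z| = ρ` in the punctured open unit ball. -/
instance (R : Subring (Cp v)) : UniformSpace (ConvergentLaurent R) :=
  UniformSpace.comap
    (fun f => UniformOnFun.ofFun (circles v) fun z : PuncturedBall v => f.eval z.1) inferInstance

/-- The inclusion `𝒪((x))₁ → K((x))₁`. -/
def inclOK (v : HeightOneSpectrum k[X]) :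
    ConvergentLaurent (subO v) →+* ConvergentLaurent (subK v) :=
  Subring.inclusion fun _ hf => ⟨fun n => subO_le_subK v (hf.1 n), hf.2⟩

end Laurent

end DrinfeldColeman

end

open DrinfeldColeman

/-!
Write `P = Φ_π` and `W = Φ[𝔭]`. Maximal height and monicity make `P` a distinguished polynomial
over `𝒪` with `P ≡ x ^ Q` modulo `π`, where `Q = deg P` is a power of the order of the residue
field. It is additive, and `W` is its set of zeros, all simple (`exists_isTorsionPolynomial`).

The norm on power series is a determinant. By Weierstrass division `𝒪⟦x⟧` is free over its
subring `{h ∘ P}` with basis `1, x, …, x ^ (Q - 1)`, and `seriesNorm` is the norm of this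
extension, where `h ∘ P` is identified with `h`. At a point `w = P z` of the open unit ball the
matrix of multiplication by `f` is diagonalized by the Vandermonde matrix of the fibre
`{z + u : u ∈ W}`, with eigenvalues `f (z + u)`. This gives the product formula
`∏ f (z + u) = (Norm f) (P z)` (`prod_seriesEval`).

By Gauss's lemma on all smaller discs, a unit of `K((x))₁` is of the form `c x ^ m h` with `c` a
nonzero constant and `h` a unit of `𝒪⟦x⟧` (`surjective_unitOfTriple`), and a unit of `𝒪((x))₁` is
uniquely of the form `x ^ m h` (`unitsEquiv`). As `∏ (x + u) = P`, the norm operator is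
`c x ^ m h ↦ c ^ Q x ^ m Norm h` (`normOperator`). In particular the absolute value of a unit is
constant on circles. The preimage of a circle under `P` lies on finitely many circles
(`finite_norms_of_norm_eval_eq`) and `P` is surjective on `𝐂_𝔭`, so the product formula bounds the
norm operator on a circle by the argument on finitely many circles, whence its continuity
(`continuous_normOperator`).

For the iterates, `g ^ Q ≡ g ∘ P` modulo `π` gives `Norm g ≡ g` modulo `π`
(`C_dvd_seriesNorm_sub_self`), and the norm raises a congruence `g ≡ 1` modulo `π ^ i` to one
modulo `π ^ (i + 1)` (`C_pow_succ_dvd_seriesNorm_sub_one`). Hence the iterates of `Norm` on a unit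
of `𝒪⟦x⟧` are congruent to a limit, the `n`-th one modulo `π ^ n`. On a circle this is a relative
error of at most `|π| ^ n`, uniformly in `g`, which yields the locally uniform convergence
(`tendstoLocallyUniformly_iterate_conjUnits`) and the continuity of the limit.
-/

/-! ### Expansions in powers of a distinguished polynomial -/

namespace DrinfeldColeman

section Weierstrass

variable {R : Type*} [CommRing R]

theorem hasSubst_coe {P : R[X]} (h0 : P.coeff 0 = 0) :
    PowerSeries.HasSubst (P : PowerSeries R) :=
  PowerSeries.HasSubst.of_constantCoeff_zero' (by simpa using h0)

/-- The ring endomorphism `h ↦ h ∘ P` of `R⟦X⟧`, for a polynomial `P` without constant term. -/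
noncomputable def compHom (P : R[X]) (h0 : P.coeff 0 = 0) : PowerSeries R →+* PowerSeries R :=
  (PowerSeries.substAlgHom (R := R) (hasSubst_coe h0) : PowerSeries R →ₐ[R] PowerSeries R)

variable {P : R[X]} {h0 : P.coeff 0 = 0}

theorem compHom_X : compHom P h0 PowerSeries.X = (P : PowerSeries R) :=
  PowerSeries.substAlgHom_X (hasSubst_coe h0)

theorem compHom_C (a : R) : compHom P h0 (PowerSeries.C a) = PowerSeries.C a :=
  (PowerSeries.substAlgHom (R := R) (hasSubst_coe h0) :
    PowerSeries R →ₐ[R] PowerSeries R).commutes a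

theorem X_dvd_coe (h0 : P.coeff 0 = 0) : PowerSeries.X ∣ (P : PowerSeries R) := by
  rw [PowerSeries.X_dvd_iff]
  simpa using h0

theorem eq_C_add_X_mul (f : PowerSeries R) :
    f = PowerSeries.C (PowerSeries.coeff 0 f) +
      PowerSeries.X * PowerSeries.mk fun n => PowerSeries.coeff (n + 1) f := by
  rw [add_comm]
  simpa using PowerSeries.eq_X_mul_shift_add_const f

theorem eq_zero_of_forall_X_pow_dvd {f : PowerSeries R}
    (h : ∀ N : ℕ, (PowerSeries.X : PowerSeries R) ^ N ∣ f) : f = 0 := by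
  ext n
  exact PowerSeries.X_pow_dvd_iff.mp (h (n + 1)) n n.lt_succ_self

/-- The linear combination `∑ i < deg P, h i (P) * X ^ i` of the powers of `X`. -/
noncomputable def expansion (P : R[X]) (h0 : P.coeff 0 = 0) (h : Fin P.natDegree → PowerSeries R) :
    PowerSeries R :=
  ∑ i : Fin P.natDegree, compHom P h0 (h i) * PowerSeries.X ^ (i : ℕ)

theorem expansion_C (c : Fin P.natDegree → R) :
    expansion P h0 (fun i => PowerSeries.C (c i)) =
      ((∑ i : Fin P.natDegree, Polynomial.monomial (i : ℕ) (c i) : R[X]) : PowerSeries R) := by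
  rw [← Polynomial.coeToPowerSeries.ringHom_apply, map_sum, expansion]
  refine Finset.sum_congr rfl fun i _ => ?_
  rw [compHom_C, Polynomial.coeToPowerSeries.ringHom_apply, Polynomial.coe_monomial,
    PowerSeries.monomial_eq_C_mul_X_pow]

theorem expansion_C_add_X_mul (c : Fin P.natDegree → R) (h : Fin P.natDegree → PowerSeries R) :
    expansion P h0 (fun i => PowerSeries.C (c i) + PowerSeries.X * h i) =
      expansion P h0 (fun i => PowerSeries.C (c i)) + P * expansion P h0 h := by
  simp only [expansion, map_add, map_mul, compHom_X, Finset.mul_sum, ← Finset.sum_add_distrib]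
  exact Finset.sum_congr rfl fun i _ => by ring

theorem expansion_sub (h h' : Fin P.natDegree → PowerSeries R) :
    expansion P h0 (h - h') = expansion P h0 h - expansion P h0 h' := by
  simp [expansion, sub_mul]

theorem expansion_add (h h' : Fin P.natDegree → PowerSeries R) :
    expansion P h0 (h + h') = expansion P h0 h + expansion P h0 h' := by
  simp [expansion, add_mul, Finset.sum_add_distrib]

variable [IsLocalRing R]

theorem map_residue_ne_zero (hP : P.IsDistinguishedAt (IsLocalRing.maximalIdeal R)) :
    (P : PowerSeries R).map (IsLocalRing.residue R) ≠ 0 := by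
  intro h
  have := congrArg (PowerSeries.coeff P.natDegree) h
  simp [hP.monic.coeff_natDegree] at this

theorem toNat_order_map_residue (hP : P.IsDistinguishedAt (IsLocalRing.maximalIdeal R)) :
    ((P : PowerSeries R).map (Ideal.Quotient.mk (IsLocalRing.maximalIdeal R))).order.toNat =
      P.natDegree := by
  rw [← Polynomial.polynomial_map_coe, hP.map_eq_X_pow]
  simp [PowerSeries.order_X_pow]

variable [IsAdicComplete (IsLocalRing.maximalIdeal R) R]

theorem degree_weierstrassMod_lt_natDegree (hP : P.IsDistinguishedAt (IsLocalRing.maximalIdeal R))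
    (f : PowerSeries R) : (f.weierstrassMod (P : PowerSeries R)).degree < P.natDegree := by
  rw [← toNat_order_map_residue hP]
  exact (f.isWeierstrassDivision_weierstrassDiv_weierstrassMod
    (map_residue_ne_zero hP)).degree_lt

/-- Iterated Weierstrass division by `P` collects the digits of `f` in base `P`. -/
theorem exists_expansion_eq (hP : P.IsDistinguishedAt (IsLocalRing.maximalIdeal R))
    (h0 : P.coeff 0 = 0) (f : PowerSeries R) : ∃ h, expansion P h0 h = f := by
  let D : PowerSeries R → Fin P.natDegree → PowerSeries R := fun f i =>
    PowerSeries.mk fun n =>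
      (((fun g : PowerSeries R => g.weierstrassDiv (P : PowerSeries R))^[n] f).weierstrassMod
        (P : PowerSeries R)).coeff i
  have hD : ∀ f i, D f i = PowerSeries.C ((f.weierstrassMod (P : PowerSeries R)).coeff i) +
      PowerSeries.X * D (f.weierstrassDiv (P : PowerSeries R)) i := by
    intro f i
    refine (eq_C_add_X_mul (D f i)).trans ?_
    simp [D]
  have step : ∀ f, f - expansion P h0 (D f) = P * (f.weierstrassDiv (P : PowerSeries R) -
      expansion P h0 (D (f.weierstrassDiv (P : PowerSeries R)))) := by
    intro f
    have h1 : D f = fun i : Fin P.natDegree =>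
        PowerSeries.C ((f.weierstrassMod (P : PowerSeries R)).coeff i) +
        PowerSeries.X * D (f.weierstrassDiv (P : PowerSeries R)) i := funext (hD f)
    have h2 := f.eq_mul_weierstrassDiv_add_weierstrassMod (map_residue_ne_zero hP)
    have h3 : (∑ i : Fin P.natDegree, Polynomial.monomial (i : ℕ)
        ((f.weierstrassMod (P : PowerSeries R)).coeff i)) =
        f.weierstrassMod (P : PowerSeries R) := by
      rw [Fin.sum_univ_eq_sum_range (fun i => Polynomial.monomial i
        ((f.weierstrassMod (P : PowerSeries R)).coeff i))]
      by_cases hn : f.weierstrassMod (P : PowerSeries R) = 0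
      · simp [hn]
      · refine (Polynomial.as_sum_range' _ _ ?_).symm
        exact (Polynomial.natDegree_lt_iff_degree_lt hn).mpr
          (degree_weierstrassMod_lt_natDegree hP f)
    rw [h1, expansion_C_add_X_mul, expansion_C, h3]
    nth_rewrite 1 [h2]
    ring
  have key : ∀ N f, (PowerSeries.X : PowerSeries R) ^ N ∣ f - expansion P h0 (D f) := by
    intro N
    induction N with
    | zero => simp
    | succ N ih =>
      intro f
      rw [step, pow_succ']
      exact mul_dvd_mul (X_dvd_coe h0) (ih _)
  exact ⟨D f, (sub_eq_zero.mp (eq_zero_of_forall_X_pow_dvd fun N => key N f)).symm⟩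

theorem eq_zero_of_expansion_eq_zero (hP : P.IsDistinguishedAt (IsLocalRing.maximalIdeal R))
    {h : Fin P.natDegree → PowerSeries R} (hh : expansion P h0 h = 0) : h = 0 := by
  have key : ∀ N (h : Fin P.natDegree → PowerSeries R), expansion P h0 h = 0 →
      ∀ i, (PowerSeries.X : PowerSeries R) ^ N ∣ h i := by
    intro N
    induction N with
    | zero => simp
    | succ N ih =>
      intro h hh
      let t : Fin P.natDegree → PowerSeries R := fun i =>
        PowerSeries.mk fun n => PowerSeries.coeff (n + 1) (h i)
      have ht : h = fun i => PowerSeries.C (PowerSeries.coeff 0 (h i)) + PowerSeries.X * t i :=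
        funext fun i => eq_C_add_X_mul (h i)
      have hdiv : PowerSeries.IsWeierstrassDivision (0 : PowerSeries R) P (expansion P h0 t)
          (∑ i : Fin P.natDegree, Polynomial.monomial (i : ℕ) (PowerSeries.coeff 0 (h i))) := by
        refine ⟨?_, ?_⟩
        · rw [toNat_order_map_residue hP]
          refine (Polynomial.degree_sum_le _ _).trans_lt ?_
          rw [Finset.sup_lt_iff (WithBot.bot_lt_coe _)]
          intro i _
          exact (Polynomial.degree_monomial_le _ _).trans_lt (by exact_mod_cast i.2)
        · rw [← hh, ht, expansion_C_add_X_mul, expansion_C, add_comm]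
          simp
      obtain ⟨h1, h2⟩ := hdiv.eq_zero (map_residue_ne_zero hP)
      intro i
      have h3 : PowerSeries.coeff 0 (h i) = 0 := by
        have := congrArg (fun p => Polynomial.coeff p i) h2
        simpa [Polynomial.finsetSum_coeff, Polynomial.coeff_monomial, Fin.val_inj] using this
      rw [congrFun ht i, h3, map_zero, zero_add, pow_succ']
      exact mul_dvd_mul_left _ (ih t h1 i)
  funext i
  exact eq_zero_of_forall_X_pow_dvd fun N => key N h hh i

theorem expansion_injective (hP : P.IsDistinguishedAt (IsLocalRing.maximalIdeal R)) :
    Function.Injective (expansion P h0) := by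
  intro h h' hh
  exact sub_eq_zero.mp (eq_zero_of_expansion_eq_zero (h0 := h0) hP
    (by rw [expansion_sub, hh, sub_self]))

/-- The coordinates of `f` in its expansion `f = ∑ i < deg P, h i (P) * X ^ i`. -/
noncomputable def expansionCoeff (hP : P.IsDistinguishedAt (IsLocalRing.maximalIdeal R))
    (h0 : P.coeff 0 = 0) (f : PowerSeries R) : Fin P.natDegree → PowerSeries R :=
  (exists_expansion_eq hP h0 f).choose

theorem expansion_expansionCoeff (hP : P.IsDistinguishedAt (IsLocalRing.maximalIdeal R))
    (h0 : P.coeff 0 = 0) (f : PowerSeries R) : expansion P h0 (expansionCoeff hP h0 f) = f :=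
  (exists_expansion_eq hP h0 f).choose_spec

theorem expansionCoeff_expansion (hP : P.IsDistinguishedAt (IsLocalRing.maximalIdeal R))
    (h : Fin P.natDegree → PowerSeries R) : expansionCoeff hP h0 (expansion P h0 h) = h :=
  expansion_injective hP (expansion_expansionCoeff hP h0 _)

/-- The matrix of multiplication by `f` on `R⟦X⟧` in the basis `1, X, …` over the subring
`{h ∘ P}`, which is identified with `R⟦X⟧` by `h ↦ h ∘ P`. -/
noncomputable def mulMatrix (hP : P.IsDistinguishedAt (IsLocalRing.maximalIdeal R))
    (h0 : P.coeff 0 = 0) :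
    PowerSeries R →+* Matrix (Fin P.natDegree) (Fin P.natDegree) (PowerSeries R) where
  toFun f := Matrix.of fun j i => expansionCoeff hP h0 (f * PowerSeries.X ^ (i : ℕ)) j
  map_zero' := by
    ext1 j i
    have h : expansion P h0 (0 : Fin P.natDegree → PowerSeries R) = 0 := by simp [expansion]
    rw [Matrix.of_apply, zero_mul, ← h, expansionCoeff_expansion]
    rfl
  map_one' := by
    ext1 j i
    have h : expansion P h0 (fun j => (1 : Matrix (Fin P.natDegree) (Fin P.natDegree)
        (PowerSeries R)) j i) = PowerSeries.X ^ (i : ℕ) := by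
      rw [expansion, Finset.sum_eq_single i]
      · simp
      · intro j _ hj
        simp [Matrix.one_apply_ne hj]
      · simp
    rw [Matrix.of_apply, one_mul, ← h, expansionCoeff_expansion]
  map_add' f g := by
    ext1 j i
    rw [Matrix.add_apply, Matrix.of_apply, Matrix.of_apply, Matrix.of_apply, ← Pi.add_apply]
    refine congrFun (expansion_injective (h0 := h0) hP ?_) j
    rw [expansion_add]
    simp only [expansion_expansionCoeff, add_mul]
  map_mul' f g := by
    ext1 j i
    rw [Matrix.mul_apply]
    simp only [Matrix.of_apply]
    have h : expansion P h0 (fun j => ∑ l : Fin P.natDegree,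
        expansionCoeff hP h0 (f * PowerSeries.X ^ (l : ℕ)) j *
        expansionCoeff hP h0 (g * PowerSeries.X ^ (i : ℕ)) l) =
        f * g * PowerSeries.X ^ (i : ℕ) := by
      conv_rhs => rw [mul_assoc, ← expansion_expansionCoeff hP h0 (g * PowerSeries.X ^ (i : ℕ))]
      simp only [expansion, map_sum, map_mul, Finset.sum_mul, Finset.mul_sum]
      rw [Finset.sum_comm]
      refine Finset.sum_congr rfl fun l _ => ?_
      have h1 := expansion_expansionCoeff hP h0 (f * PowerSeries.X ^ (l : ℕ))
      rw [expansion] at h1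
      rw [mul_left_comm, ← mul_assoc, mul_assoc, ← h1, Finset.mul_sum]
      exact Finset.sum_congr rfl fun j _ => by rw [h1]; ring
    rw [← h, expansionCoeff_expansion]

theorem sum_compHom_mulMatrix (hP : P.IsDistinguishedAt (IsLocalRing.maximalIdeal R))
    (h0 : P.coeff 0 = 0) (f : PowerSeries R) (i : Fin P.natDegree) :
    ∑ j, compHom P h0 (mulMatrix hP h0 f j i) * PowerSeries.X ^ (j : ℕ) =
      f * PowerSeries.X ^ (i : ℕ) :=
  expansion_expansionCoeff hP h0 _

theorem mulMatrix_compHom (hP : P.IsDistinguishedAt (IsLocalRing.maximalIdeal R))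
    (h0 : P.coeff 0 = 0) (h : PowerSeries R) :
    mulMatrix hP h0 (compHom P h0 h) = Matrix.scalar _ h := by
  ext1 j i
  have h1 : expansion P h0 (fun j => Matrix.scalar (Fin P.natDegree) h j i) =
      compHom P h0 h * PowerSeries.X ^ (i : ℕ) := by
    rw [expansion, Finset.sum_eq_single i]
    · simp
    · intro j _ hj
      simp [Matrix.diagonal_apply_ne _ hj]
    · simp
  change expansionCoeff hP h0 _ j = _
  rw [← h1, expansionCoeff_expansion]

theorem mulMatrix_C (hP : P.IsDistinguishedAt (IsLocalRing.maximalIdeal R))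
    (h0 : P.coeff 0 = 0) (a : R) :
    mulMatrix hP h0 (PowerSeries.C a) = Matrix.scalar _ (PowerSeries.C a) := by
  rw [← mulMatrix_compHom hP h0, compHom_C]

/-- The norm of `R⟦X⟧` over its subring `{h ∘ P}`, as an endomorphism of the monoid `R⟦X⟧`. -/
noncomputable def seriesNorm (hP : P.IsDistinguishedAt (IsLocalRing.maximalIdeal R))
    (h0 : P.coeff 0 = 0) : PowerSeries R →* PowerSeries R :=
  Matrix.detMonoidHom.comp (mulMatrix hP h0).toMonoidHom

theorem seriesNorm_apply (hP : P.IsDistinguishedAt (IsLocalRing.maximalIdeal R))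
    (h0 : P.coeff 0 = 0) (f : PowerSeries R) : seriesNorm hP h0 f = (mulMatrix hP h0 f).det := rfl

theorem seriesNorm_C (hP : P.IsDistinguishedAt (IsLocalRing.maximalIdeal R))
    (h0 : P.coeff 0 = 0) (a : R) :
    seriesNorm hP h0 (PowerSeries.C a) = PowerSeries.C a ^ P.natDegree := by
  rw [seriesNorm_apply, mulMatrix_C]
  simp

end Weierstrass

/-! ### Congruences for the norm of power series -/

section Congruence

variable {R : Type*} [CommRing R]

theorem C_dvd_iff_forall_dvd_coeff {c : R} {f : PowerSeries R} :
    PowerSeries.C c ∣ f ↔ ∀ n, c ∣ PowerSeries.coeff n f := by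
  constructor
  · rintro ⟨g, rfl⟩ n
    exact ⟨_, PowerSeries.coeff_C_mul n g c⟩
  · intro h
    choose g hg using h
    exact ⟨PowerSeries.mk g, by ext n; rw [PowerSeries.coeff_C_mul, PowerSeries.coeff_mk, hg]⟩

theorem prime_C_of_prime [IsDomain R] {c : R} (hc : Prime c) :
    Prime (PowerSeries.C c : PowerSeries R) := by
  have hc' : (Ideal.span {c}).IsPrime := (Ideal.span_singleton_prime hc.ne_zero).mpr hc
  have key : ∀ f : PowerSeries R, PowerSeries.C c ∣ f ↔
      f.map (Ideal.Quotient.mk (Ideal.span {c})) = 0 := by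
    intro f
    rw [C_dvd_iff_forall_dvd_coeff, PowerSeries.ext_iff]
    refine forall_congr' fun n => ?_
    rw [PowerSeries.coeff_map, map_zero, Ideal.Quotient.eq_zero_iff_mem,
      Ideal.mem_span_singleton]
  refine ⟨fun h => hc.ne_zero (PowerSeries.C_injective (h.trans (map_zero _).symm)), fun h => ?_,
    fun f g hfg => ?_⟩
  · refine hc.not_isUnit ?_
    have := h.map (PowerSeries.constantCoeff (R := R))
    simpa using this
  · rw [key, map_mul, mul_eq_zero] at hfg
    rwa [key, key]

theorem dvd_det_add_smul_sub_det {n : Type*} [Fintype n] [DecidableEq n] (c : R)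
    (A B : Matrix n n R) : c ∣ (A + c • B).det - A.det := by
  rw [← Ideal.mem_span_singleton, ← Ideal.Quotient.eq_zero_iff_mem, map_sub, sub_eq_zero,
    RingHom.map_det, RingHom.map_det]
  congr 1
  ext i j
  have hc : Ideal.Quotient.mk (Ideal.span {c}) c = 0 :=
    Ideal.Quotient.eq_zero_iff_mem.mpr (Ideal.mem_span_singleton_self c)
  simp [hc]

/-- In characteristic `p`, composition with `P ≡ X ^ Q` agrees with the `Q`-th power map modulo
`ϖ`, if `Q` is a power of `p` and `a ^ Q ≡ a` for all coefficients `a`. -/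
theorem C_dvd_pow_sub_compHom {p e : ℕ} [Fact p.Prime] [CharP R p] {P : R[X]} {h0 : P.coeff 0 = 0}
    {ϖ : R} (hfrob : ∀ a : R, ϖ ∣ a ^ p ^ e - a) (hPX : C ϖ ∣ P - X ^ p ^ e)
    (f : PowerSeries R) : PowerSeries.C ϖ ∣ f ^ p ^ e - compHom P h0 f := by
  have hQ : 1 ≤ p ^ e := Nat.one_le_pow _ _ (Fact.out : p.Prime).pos
  have hchar : CharP (PowerSeries R) p :=
    charP_of_injective_ringHom (PowerSeries.C_injective (R := R)) p
  have hPX' : PowerSeries.C ϖ ∣ (P : PowerSeries R) - PowerSeries.X ^ p ^ e := by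
    simpa using map_dvd (Polynomial.coeToPowerSeries.ringHom (R := R)) hPX
  have hpoly : ∀ T : R[X], PowerSeries.C ϖ ∣
      (T : PowerSeries R) ^ p ^ e - compHom P h0 (T : PowerSeries R) := by
    intro T
    induction T using Polynomial.induction_on' with
    | add S T hS hT =>
      have h1 : ((S + T : R[X]) : PowerSeries R) ^ p ^ e - compHom P h0 ((S + T : R[X])) =
          ((S : PowerSeries R) ^ p ^ e - compHom P h0 S) +
          ((T : PowerSeries R) ^ p ^ e - compHom P h0 T) := by
        rw [Polynomial.coe_add, add_pow_char_pow, map_add]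
        ring
      rw [h1]
      exact dvd_add hS hT
    | monomial n a =>
      rw [Polynomial.coe_monomial, PowerSeries.monomial_eq_C_mul_X_pow, mul_pow, map_mul, map_pow,
        compHom_C, compHom_X]
      have h1 : PowerSeries.C ϖ ∣ PowerSeries.C a ^ p ^ e - PowerSeries.C a := by
        simpa using map_dvd (PowerSeries.C (R := R)) (hfrob a)
      have h2 : PowerSeries.C ϖ ∣ (P : PowerSeries R) ^ n - (PowerSeries.X ^ p ^ e) ^ n :=
        hPX'.trans (sub_dvd_pow_sub_pow _ _ n)
      have h3 : PowerSeries.C a ^ p ^ e * (PowerSeries.X ^ n) ^ p ^ e -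
          PowerSeries.C a * (P : PowerSeries R) ^ n =
          (PowerSeries.C a ^ p ^ e - PowerSeries.C a) * (PowerSeries.X ^ n) ^ p ^ e -
          PowerSeries.C a * ((P : PowerSeries R) ^ n - (PowerSeries.X ^ p ^ e) ^ n) := by
        rw [← pow_mul PowerSeries.X, ← pow_mul PowerSeries.X, mul_comm n]
        ring
      rw [h3]
      exact dvd_sub (h1.mul_right _) (h2.mul_left _)
  rw [C_dvd_iff_forall_dvd_coeff]
  intro n
  -- the coefficient of `X ^ n` depends only on the truncation of `f` at degree `n + 1`
  set T : R[X] := PowerSeries.trunc (n + 1) f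
  obtain ⟨g, hg⟩ : ∃ g, f = PowerSeries.X ^ (n + 1) * g + (T : PowerSeries R) :=
    ⟨_, PowerSeries.eq_X_pow_mul_shift_add_trunc (n + 1) f⟩
  have h1 : f ^ p ^ e - compHom P h0 f = ((T : PowerSeries R) ^ p ^ e - compHom P h0 T) +
      ((PowerSeries.X ^ (n + 1)) ^ p ^ e * g ^ p ^ e -
        (P : PowerSeries R) ^ (n + 1) * compHom P h0 g) := by
    conv_lhs => rw [hg, add_pow_char_pow, map_add, mul_pow, map_mul, map_pow, compHom_X]
    ring
  have h2 : (PowerSeries.X : PowerSeries R) ^ (n + 1) ∣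
      (PowerSeries.X ^ (n + 1)) ^ p ^ e * g ^ p ^ e -
        (P : PowerSeries R) ^ (n + 1) * compHom P h0 g :=
    dvd_sub ((dvd_pow_self _ (by omega)).mul_right _)
      ((pow_dvd_pow_of_dvd (X_dvd_coe h0) _).mul_right _)
  rw [h1, map_add, PowerSeries.X_pow_dvd_iff.mp h2 n n.lt_succ_self, add_zero]
  exact C_dvd_iff_forall_dvd_coeff.mp (hpoly T) n

theorem det_scalar_fin {n m : ℕ} (h : n = m) (a : R) :
    (Matrix.scalar (Fin n) a).det = a ^ m := by
  simp [h]

theorem eq_zero_of_forall_C_pow_dvd [IsLocalRing R] [IsHausdorff (IsLocalRing.maximalIdeal R) R]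
    {ϖ : R} (hmax : IsLocalRing.maximalIdeal R = Ideal.span {ϖ}) {f : PowerSeries R}
    (h : ∀ n : ℕ, PowerSeries.C ϖ ^ n ∣ f) : f = 0 := by
  ext i
  refine IsHausdorff.haus (I := IsLocalRing.maximalIdeal R) inferInstance _ fun n => ?_
  rw [SModEq.zero, smul_eq_mul, Ideal.mul_top, hmax, Ideal.span_singleton_pow,
    Ideal.mem_span_singleton]
  have := h n
  rw [← map_pow] at this
  exact C_dvd_iff_forall_dvd_coeff.mp this i

variable [IsDomain R] [IsLocalRing R] [IsAdicComplete (IsLocalRing.maximalIdeal R) R]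
  {p e : ℕ} [Fact p.Prime] [CharP R p] {P : R[X]}
  (hP : P.IsDistinguishedAt (IsLocalRing.maximalIdeal R)) (h0 : P.coeff 0 = 0)
  (hdeg : P.natDegree = p ^ e) {ϖ : R} (hϖ : Prime ϖ) (hfrob : ∀ a : R, ϖ ∣ a ^ p ^ e - a)
  (hPX : C ϖ ∣ P - X ^ p ^ e)

include hdeg hϖ hfrob hPX

/-- The matrix of `g ^ Q` is congruent to the scalar matrix `g`, since `g ^ Q ≡ g ∘ P`. Its
determinant `(Norm g) ^ Q` is therefore congruent to `g ^ Q`, and the `Q`-th root may be taken in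
the domain `(R / ϖ)⟦X⟧` of characteristic `p`. -/
theorem C_dvd_seriesNorm_sub_self (g : PowerSeries R) :
    PowerSeries.C ϖ ∣ seriesNorm hP h0 g - g := by
  have hchar : CharP (PowerSeries R) p :=
    charP_of_injective_ringHom (PowerSeries.C_injective (R := R)) p
  obtain ⟨t, ht⟩ := C_dvd_pow_sub_compHom (h0 := h0) hfrob hPX g
  have h1 : mulMatrix hP h0 g ^ p ^ e =
      Matrix.scalar _ g + PowerSeries.C ϖ • mulMatrix hP h0 t := by
    rw [← map_pow, eq_add_of_sub_eq' ht, map_add, map_mul, mulMatrix_compHom, mulMatrix_C,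
      Matrix.scalar_apply (PowerSeries.C ϖ), ← Matrix.smul_eq_diagonal_mul]
  have h2 := dvd_det_add_smul_sub_det (PowerSeries.C ϖ) (Matrix.scalar _ g) (mulMatrix hP h0 t)
  rw [← h1, Matrix.det_pow, det_scalar_fin hdeg, ← sub_pow_char_pow] at h2
  exact (prime_C_of_prime hϖ).dvd_of_dvd_pow h2

/-- The norm improves congruences to `1`. If `g = 1 + ϖ ^ i f`, then modulo `ϖ ^ (iQ + 1)` the
power `g ^ Q = 1 + ϖ ^ (iQ) f ^ Q` is congruent to the series `1 + ϖ ^ (iQ) f` composed with `P`,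
whose matrix is scalar; hence `ϖ ^ (iQ + 1)` divides `Norm (g ^ Q) - 1 = (Norm g - 1) ^ Q`, and
as `ϖ` is prime, `ϖ ^ (i + 1)` divides `Norm g - 1`. -/
theorem C_pow_succ_dvd_seriesNorm_sub_one {i : ℕ} (hi : 1 ≤ i) (he : 1 ≤ e) {g : PowerSeries R}
    (hg : PowerSeries.C ϖ ^ i ∣ g - 1) : PowerSeries.C ϖ ^ (i + 1) ∣ seriesNorm hP h0 g - 1 := by
  have hchar : CharP (PowerSeries R) p :=
    charP_of_injective_ringHom (PowerSeries.C_injective (R := R)) p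
  have hprime := prime_C_of_prime hϖ
  have hQ : 2 ≤ p ^ e :=
    (Fact.out : p.Prime).two_le.trans (Nat.le_self_pow (by omega) p)
  obtain ⟨f, hf⟩ := hg
  obtain ⟨t, ht⟩ := C_dvd_pow_sub_compHom (h0 := h0) hfrob hPX f
  set c : PowerSeries R := PowerSeries.C ϖ with hc
  have hcS : ∀ n : ℕ, mulMatrix hP h0 (c ^ n) = Matrix.scalar _ (c ^ n) := by
    intro n
    rw [map_pow, hc, mulMatrix_C, map_pow]
  have h1 : g ^ p ^ e = compHom P h0 (1 + c ^ (i * p ^ e) * f) + c ^ (i * p ^ e + 1) * t := by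
    rw [eq_add_of_sub_eq' hf, add_pow_char_pow, one_pow, mul_pow, ← pow_mul,
      eq_add_of_sub_eq' ht, map_add, map_mul, map_one, map_pow, hc, compHom_C]
    ring
  have h2 : mulMatrix hP h0 g ^ p ^ e = Matrix.scalar _ (1 + c ^ (i * p ^ e) * f) +
      c ^ (i * p ^ e + 1) • mulMatrix hP h0 t := by
    rw [← map_pow, h1, map_add, map_mul, mulMatrix_compHom, hcS,
      Matrix.scalar_apply (c ^ (i * p ^ e + 1)), ← Matrix.smul_eq_diagonal_mul]
  have h3 := dvd_det_add_smul_sub_det (c ^ (i * p ^ e + 1))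
    (Matrix.scalar _ (1 + c ^ (i * p ^ e) * f)) (mulMatrix hP h0 t)
  rw [← h2, Matrix.det_pow, det_scalar_fin hdeg, add_pow_char_pow, one_pow, mul_pow,
    ← pow_mul] at h3
  have h4 : c ^ (i * p ^ e + 1) ∣ c ^ (i * p ^ e * p ^ e) * f ^ p ^ e := by
    refine (pow_dvd_pow c ?_).mul_right _
    have : 1 ≤ i * p ^ e := Nat.mul_pos hi (by omega)
    nlinarith
  have h5 : c ^ (i * p ^ e + 1) ∣ (seriesNorm hP h0 g - 1) ^ p ^ e := by
    rw [sub_pow_char_pow, one_pow, seriesNorm_apply]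
    have := dvd_add h3 h4
    rwa [← sub_sub, sub_add_cancel] at this
  rw [pow_dvd_iff_le_emultiplicity, emultiplicity_pow hprime] at h5
  rw [pow_dvd_iff_le_emultiplicity]
  by_contra hlt
  obtain ⟨m, hm⟩ := ENat.ne_top_iff_exists.mp (ne_top_of_lt (not_le.mp hlt))
  rw [← hm] at h5 hlt
  norm_cast at h5 hlt
  have : m ≤ i := by omega
  have := Nat.mul_le_mul_left (p ^ e) this
  rw [mul_comm i] at h5
  omega

/-- The endomorphism of the unit group of `R⟦X⟧` given by the norm. -/
noncomputable def unitsNorm (hP : P.IsDistinguishedAt (IsLocalRing.maximalIdeal R))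
    (h0 : P.coeff 0 = 0) : (PowerSeries R)ˣ →* (PowerSeries R)ˣ := Units.map (seriesNorm hP h0)

theorem C_pow_dvd_iterate_div_sub_one (he : 1 ≤ e) (g : (PowerSeries R)ˣ) (n : ℕ) :
    PowerSeries.C ϖ ^ (n + 1) ∣
      (((unitsNorm hP h0)^[n + 1] g / (unitsNorm hP h0)^[n] g : (PowerSeries R)ˣ) :
        PowerSeries R) - 1 := by
  induction n with
  | zero =>
    have h := C_dvd_seriesNorm_sub_self hP h0 hdeg hϖ hfrob hPX (g : PowerSeries R)
    have h1 := h.mul_right ((g⁻¹ : (PowerSeries R)ˣ) : PowerSeries R)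
    rw [sub_mul, Units.mul_inv] at h1
    simpa [div_eq_mul_inv, unitsNorm] using h1
  | succ n ih =>
    have := C_pow_succ_dvd_seriesNorm_sub_one hP h0 hdeg hϖ hfrob hPX n.succ_pos he ih
    have h1 := Function.iterate_succ_apply' (unitsNorm hP h0) (n + 1) g
    have h2 := Function.iterate_succ_apply' (unitsNorm hP h0) n g
    rw [h1]
    nth_rewrite 2 [h2]
    rw [← _root_.map_div]
    exact this

theorem C_pow_dvd_iterate_sub_iterate (he : 1 ≤ e) (g : (PowerSeries R)ˣ) {n m : ℕ} (h : n ≤ m) :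
    PowerSeries.C ϖ ^ n ∣ (((unitsNorm hP h0)^[m] g : (PowerSeries R)ˣ) : PowerSeries R) -
      ((unitsNorm hP h0)^[n] g : (PowerSeries R)ˣ) := by
  induction m, h using Nat.le_induction with
  | base => simp
  | succ m hm ih =>
    have h1 := (C_pow_dvd_iterate_div_sub_one hP h0 hdeg hϖ hfrob hPX he g m).mul_right
      (((unitsNorm hP h0)^[m] g : (PowerSeries R)ˣ) : PowerSeries R)
    rw [sub_mul, one_mul, ← Units.val_mul, div_mul_cancel] at h1
    have h2 := dvd_add ((pow_dvd_pow (PowerSeries.C ϖ) (by omega : n ≤ m + 1)).trans h1) ih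
    rwa [sub_add_sub_cancel] at h2

variable (hmax : IsLocalRing.maximalIdeal R = Ideal.span {ϖ})
include hmax

theorem exists_unit_forall_C_pow_dvd_iterate_sub (he : 1 ≤ e) (g : (PowerSeries R)ˣ) :
    ∃ l : (PowerSeries R)ˣ, ∀ n : ℕ, PowerSeries.C ϖ ^ n ∣
      (((unitsNorm hP h0)^[n] g : (PowerSeries R)ˣ) : PowerSeries R) - l := by
  let u : ℕ → PowerSeries R := fun n => ((unitsNorm hP h0)^[n] g : (PowerSeries R)ˣ)
  have hmem : ∀ (n : ℕ) (a b : R), a ≡ b [SMOD (IsLocalRing.maximalIdeal R ^ n • ⊤ :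
      Submodule R R)] ↔ ϖ ^ n ∣ a - b := by
    intro n a b
    rw [SModEq.sub_mem, smul_eq_mul, Ideal.mul_top, hmax, Ideal.span_singleton_pow,
      Ideal.mem_span_singleton]
  have hcoeff : ∀ i, ∃ L : R, ∀ n, ϖ ^ n ∣ PowerSeries.coeff i (u n) - L := by
    intro i
    obtain ⟨L, hL⟩ := IsPrecomplete.prec (I := IsLocalRing.maximalIdeal R) inferInstance
      (f := fun n => PowerSeries.coeff i (u n)) (fun {m n} hmn => by
        rw [hmem, ← dvd_neg, neg_sub, ← map_sub]
        have := C_pow_dvd_iterate_sub_iterate hP h0 hdeg hϖ hfrob hPX he g hmn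
        rw [← map_pow] at this
        exact C_dvd_iff_forall_dvd_coeff.mp this i)
    exact ⟨L, fun n => (hmem n _ _).mp (hL n)⟩
  choose L hL using hcoeff
  have hl : ∀ n : ℕ, PowerSeries.C ϖ ^ n ∣ u n - PowerSeries.mk L := by
    intro n
    rw [← map_pow, C_dvd_iff_forall_dvd_coeff]
    intro i
    rw [map_sub, PowerSeries.coeff_mk]
    exact hL i n
  have hunit : IsUnit (PowerSeries.mk L) := by
    rw [PowerSeries.isUnit_iff_constantCoeff]
    have h1 : IsUnit (PowerSeries.constantCoeff (u 1)) := (Units.isUnit _).map _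
    by_contra h2
    have h3 : PowerSeries.constantCoeff (u 1) - PowerSeries.constantCoeff (PowerSeries.mk L) ∈
        IsLocalRing.maximalIdeal R := by
      rw [hmax, Ideal.mem_span_singleton]
      simpa using hL 0 1
    have h4 := (IsLocalRing.maximalIdeal R).add_mem h3 ((IsLocalRing.mem_maximalIdeal _).mpr h2)
    rw [sub_add_cancel] at h4
    exact (IsLocalRing.mem_maximalIdeal _).mp h4 h1
  exact ⟨hunit.unit, hl⟩

/-- The limit of the iterates of the norm on the unit group of `R⟦X⟧`. -/
theorem exists_monoidHom_forall_C_pow_dvd_iterate_sub (he : 1 ≤ e) :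
    ∃ l : (PowerSeries R)ˣ →* (PowerSeries R)ˣ, ∀ g (n : ℕ), PowerSeries.C ϖ ^ n ∣
      (((unitsNorm hP h0)^[n] g : (PowerSeries R)ˣ) : PowerSeries R) - l g := by
  choose l hl using
    exists_unit_forall_C_pow_dvd_iterate_sub hP h0 hdeg hϖ hfrob hPX hmax he
  refine ⟨MonoidHom.mk' l fun g g' => ?_, hl⟩
  refine Units.ext (sub_eq_zero.mp (eq_zero_of_forall_C_pow_dvd hmax fun n => ?_))
  have h1 := hl (g * g') n
  rw [iterate_map_mul, Units.val_mul] at h1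
  have h2 := dvd_sub (dvd_add ((hl g n).mul_right (((unitsNorm hP h0)^[n] g' :
    (PowerSeries R)ˣ) : PowerSeries R)) ((hl g' n).mul_left (l g : PowerSeries R))) h1
  convert h2 using 1
  push_cast
  ring

end Congruence

/-! ### The local field `K`, its ring of integers and `𝐂_𝔭` -/

theorem ne_zero_of_asIdeal_eq {k : Type*} [Field k] {v : HeightOneSpectrum k[X]} {π : k[X]}
    (hπ : v.asIdeal = Ideal.span {π}) : π ≠ 0 := by
  rintro rfl
  exact v.ne_bot (by simpa using hπ)

theorem irreducible_of_asIdeal_eq {k : Type*} [Field k] {v : HeightOneSpectrum k[X]} {π : k[X]}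
    (hπ : v.asIdeal = Ideal.span {π}) : Irreducible π := by
  have h := v.isPrime
  rw [hπ, Ideal.span_singleton_prime (ne_zero_of_asIdeal_eq hπ)] at h
  exact h.irreducible

/-- The generator `π` of `𝔭`, as an element of `𝒪`. -/
noncomputable def uniformizer {k : Type*} [Field k] (v : HeightOneSpectrum k[X])
    (π : k[X]) : LocalInt v :=
  algebraMap k[X] (LocalInt v) π

theorem valued_uniformizer {k : Type*} [Field k] {v : HeightOneSpectrum k[X]} {π : k[X]}
    (hπ : v.asIdeal = Ideal.span {π}) :
    Valued.v (uniformizer v π : LocalField v) = WithZero.exp (-1 : ℤ) := by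
  refine (HeightOneSpectrum.valuedAdicCompletion_eq_valuation v π).trans ?_
  rw [HeightOneSpectrum.valuation_of_algebraMap,
    v.intValuation_singleton (ne_zero_of_asIdeal_eq hπ) hπ]

theorem uniformizer_ne_zero {k : Type*} [Field k] {v : HeightOneSpectrum k[X]} {π : k[X]}
    (hπ : v.asIdeal = Ideal.span {π}) : uniformizer v π ≠ 0 := by
  intro h
  have := valued_uniformizer hπ
  rw [h] at this
  exact WithZero.exp_ne_zero (this.symm.trans (map_zero _))

section LocalFieldFacts

variable {k : Type*} [Field k] [Fintype k] {v : HeightOneSpectrum k[X]}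

theorem norm_embField (x : LocalField v) : ‖embField v x‖ = ‖x‖ := by
  rw [embField, RingHom.comp_apply, norm_algebraMap', norm_algebraMap']

theorem norm_embInt (a : LocalInt v) : ‖embInt v a‖ = ‖(a : LocalField v)‖ :=
  norm_embField _

theorem norm_le_one_iff_mem (x : LocalField v) :
    ‖x‖ ≤ 1 ↔ x ∈ v.adicCompletionIntegers (RatFunc k) :=
  Valued.toNormedField.norm_le_one_iff

theorem norm_embInt_le_one (a : LocalInt v) : ‖embInt v a‖ ≤ 1 := by
  rw [norm_embInt]
  exact (norm_le_one_iff_mem _).mpr a.2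

theorem exists_embInt_eq {x : LocalField v} (hx : ‖embField v x‖ ≤ 1) :
    ∃ a : LocalInt v, embInt v a = embField v x :=
  ⟨⟨x, (norm_le_one_iff_mem x).mp (by rwa [norm_embField] at hx)⟩, rfl⟩

theorem embInt_injective : Function.Injective (embInt v) :=
  (embField v).injective.comp Subtype.val_injective

variable {π : k[X]} (hπ : v.asIdeal = Ideal.span {π})
include hπ

theorem norm_uniformizer_lt_one : ‖embInt v (uniformizer v π)‖ < 1 := by
  rw [norm_embInt]
  refine Valued.toNormedField.norm_lt_one_iff.mpr ?_
  rw [valued_uniformizer hπ, ← WithZero.exp_zero, WithZero.exp_lt_exp]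
  norm_num

theorem uniformizer_pow_dvd_iff (a : LocalInt v) (n : ℕ) :
    uniformizer v π ^ n ∣ a ↔ ‖embInt v a‖ ≤ ‖embInt v (uniformizer v π)‖ ^ n := by
  constructor
  · rintro ⟨b, rfl⟩
    rw [map_mul, map_pow, norm_mul, norm_pow]
    exact mul_le_of_le_one_right (by positivity) (norm_embInt_le_one b)
  · intro h
    have h0 : (uniformizer v π : LocalField v) ^ n ≠ 0 := by
      refine pow_ne_zero _ fun h => uniformizer_ne_zero hπ (Subtype.ext h)
    have h1 : ‖(a : LocalField v) / (uniformizer v π : LocalField v) ^ n‖ ≤ 1 := by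
      rw [norm_div, norm_pow]
      rw [norm_embInt, norm_embInt] at h
      exact div_le_one_of_le₀ h (by positivity)
    refine ⟨⟨_, (norm_le_one_iff_mem _).mp h1⟩, Subtype.ext ?_⟩
    push_cast
    field_simp

omit [Fintype k] in
theorem maximalIdeal_eq_span_uniformizer :
    IsLocalRing.maximalIdeal (LocalInt v) = Ideal.span {uniformizer v π} := by
  ext a
  rw [IsLocalRing.mem_maximalIdeal, mem_nonunits_iff, Ideal.mem_span_singleton,
    HeightOneSpectrum.adicCompletionIntegers.isUnit_iff_valued_eq_one]
  constructor
  · intro h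
    have h1 : Valued.v (a : LocalField v) < WithZero.exp (0 : ℤ) := by
      rw [WithZero.exp_zero]
      exact lt_of_le_of_ne a.2 h
    by_cases ha : a = 0
    · simp [ha]
    have ha' : Valued.v (a : LocalField v) ≠ 0 :=
      (Valuation.ne_zero_iff _).mpr fun h => ha (Subtype.ext h)
    obtain ⟨m, hm⟩ : ∃ m : ℤ, Valued.v (a : LocalField v) = WithZero.exp m :=
      ⟨_, (WithZero.exp_log ha').symm⟩
    rw [hm, WithZero.exp_lt_exp] at h1
    have h2 : Valued.v ((a : LocalField v) / uniformizer v π) ≤ 1 := by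
      rw [map_div₀, hm, valued_uniformizer hπ, ← WithZero.exp_sub, ← WithZero.exp_zero,
        WithZero.exp_le_exp]
      omega
    refine ⟨⟨_, h2⟩, Subtype.ext ?_⟩
    have h0 : (uniformizer v π : LocalField v) ≠ 0 := fun h =>
      uniformizer_ne_zero hπ (Subtype.ext h)
    push_cast
    field_simp
  · rintro ⟨b, rfl⟩ h
    have h1 : Valued.v (b : LocalField v) ≤ 1 := b.2
    push_cast at h
    rw [map_mul, valued_uniformizer hπ] at h
    have h2 : WithZero.exp (-1 : ℤ) * Valued.v (b : LocalField v) ≤ WithZero.exp (-1 : ℤ) * 1 :=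
      mul_le_mul_right h1 _
    rw [h, mul_one, ← WithZero.exp_zero, WithZero.exp_le_exp] at h2
    norm_num at h2

omit [Fintype k] in
theorem prime_uniformizer : Prime (uniformizer v π) := by
  rw [← Ideal.span_singleton_prime (uniformizer_ne_zero hπ), ← maximalIdeal_eq_span_uniformizer hπ]
  exact (IsLocalRing.maximalIdeal.isMaximal _).isPrime

theorem isAdicComplete_localInt :
    IsAdicComplete (IsLocalRing.maximalIdeal (LocalInt v)) (LocalInt v) := by
  have hmem : ∀ (n : ℕ) (a b : LocalInt v), a ≡ b [SMOD
      (IsLocalRing.maximalIdeal (LocalInt v) ^ n • ⊤ : Submodule (LocalInt v) (LocalInt v))] ↔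
      ‖(a : LocalField v) - b‖ ≤ ‖embInt v (uniformizer v π)‖ ^ n := by
    intro n a b
    rw [SModEq.sub_mem, smul_eq_mul, Ideal.mul_top, maximalIdeal_eq_span_uniformizer hπ,
      Ideal.span_singleton_pow, Ideal.mem_span_singleton, uniformizer_pow_dvd_iff hπ, norm_embInt]
    push_cast
    rfl
  have hlt := norm_uniformizer_lt_one hπ
  have hlim : Tendsto (fun n : ℕ => ‖embInt v (uniformizer v π)‖ ^ n) atTop (𝓝 0) :=
    tendsto_pow_atTop_nhds_zero_of_lt_one (norm_nonneg _) hlt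
  refine { haus' := fun x hx => ?_, prec' := fun f hf => ?_ }
  · have h1 : ∀ n : ℕ, ‖(x : LocalField v)‖ ≤ ‖embInt v (uniformizer v π)‖ ^ n := fun n => by
      simpa using (hmem n x 0).mp (hx n)
    have h2 : ‖(x : LocalField v)‖ ≤ 0 := ge_of_tendsto' hlim h1
    exact Subtype.ext (norm_le_zero_iff.mp h2)
  · have hd : ∀ {m n : ℕ}, m ≤ n →
        ‖(f m : LocalField v) - f n‖ ≤ ‖embInt v (uniformizer v π)‖ ^ m :=
      fun hmn => (hmem _ _ _).mp (hf hmn)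
    have hcau : CauchySeq fun n => (f n : LocalField v) :=
      cauchySeq_of_le_geometric _ 1 hlt fun n => by
        rw [dist_eq_norm, one_mul]
        exact hd n.le_succ
    obtain ⟨L, hL⟩ := cauchySeq_tendsto_of_complete hcau
    have hL1 : ‖L‖ ≤ 1 := le_of_tendsto' hL.norm fun n => (norm_le_one_iff_mem _).mpr (f n).2
    refine ⟨⟨L, (norm_le_one_iff_mem _).mp hL1⟩, fun n => (hmem _ _ _).mpr ?_⟩
    exact le_of_tendsto (hL.const_sub _).norm
      (eventually_atTop.mpr ⟨n, fun m hm => hd hm⟩)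

theorem exists_polynomial_uniformizer_dvd_sub (a : LocalInt v) :
    ∃ b : k[X], uniformizer v π ∣ a - algebraMap k[X] (LocalInt v) b := by
  obtain ⟨x, hx⟩ : ∃ x : RatFunc k,
      Valued.v ((algebraMap (RatFunc k) (LocalField v) x) - (a : LocalField v)) < 1 := by
    have hopen : IsOpen {y : LocalField v | ‖y - a‖ < 1} :=
      isOpen_lt (by fun_prop) continuous_const
    obtain ⟨x, hx⟩ := (HeightOneSpectrum.denseRange_algebraMap (RatFunc k) v).exists_mem_open hopen
      ⟨(a : LocalField v), by simp⟩
    exact ⟨x, Valued.toNormedField.norm_lt_one_iff.mp hx⟩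
  have hxv : v.valuation (RatFunc k) x ≤ 1 := by
    rw [← HeightOneSpectrum.valuedAdicCompletion_eq_valuation']
    have h := Valuation.map_add (Valued.v : Valuation (LocalField v) _)
      ((algebraMap (RatFunc k) (LocalField v) x) - (a : LocalField v)) a
    rw [sub_add_cancel] at h
    exact h.trans (max_le hx.le a.2)
  obtain ⟨b, hb⟩ := v.exists_valuation_sub_lt_of_integer hxv 1
  refine ⟨b, ?_⟩
  rw [← Ideal.mem_span_singleton, ← maximalIdeal_eq_span_uniformizer hπ,
    IsLocalRing.mem_maximalIdeal, mem_nonunits_iff,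
    HeightOneSpectrum.adicCompletionIntegers.isUnit_iff_valued_eq_one]
  refine ne_of_lt ?_
  have h1 : ((a - algebraMap k[X] (LocalInt v) b : LocalInt v) : LocalField v) =
      (algebraMap (RatFunc k) (LocalField v)) (x - algebraMap k[X] (RatFunc k) b) -
      ((algebraMap (RatFunc k) (LocalField v) x) - (a : LocalField v)) := by
    have h2 : ((algebraMap k[X] (LocalInt v) b : LocalInt v) : LocalField v) =
        algebraMap (RatFunc k) (LocalField v) (algebraMap k[X] (RatFunc k) b) := by
      rw [HeightOneSpectrum.algebraMap_adicCompletion]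
      rfl
    rw [AddSubgroupClass.coe_sub, h2, map_sub]
    ring
  rw [h1]
  refine (Valuation.map_sub _ _ _).trans_lt (max_lt ?_ hx)
  refine (HeightOneSpectrum.valuedAdicCompletion_eq_valuation' v _).trans_lt ?_
  rw [Algebra.algebraMap_self, RingHom.id_apply, Valuation.map_sub_swap]
  simpa using hb

theorem uniformizer_dvd_pow_sub_self (r : ℕ) (a : LocalInt v) :
    uniformizer v π ∣ a ^ Fintype.card k ^ (r * π.natDegree) - a := by
  have hirr := irreducible_of_asIdeal_eq hπ
  have hpoly : ∀ b : k[X], π ∣ b ^ Fintype.card k ^ (r * π.natDegree) - b := by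
    intro b
    have : Fact (Irreducible π) := ⟨hirr⟩
    have : Module.Finite k (AdjoinRoot π) := (AdjoinRoot.powerBasis hirr.ne_zero).finite
    have : Finite (AdjoinRoot π) := Module.finite_of_finite k
    have : Fintype (AdjoinRoot π) := Fintype.ofFinite _
    have hcard : Fintype.card (AdjoinRoot π) = Fintype.card k ^ π.natDegree := by
      rw [Module.card_eq_pow_finrank (K := k), (AdjoinRoot.powerBasis hirr.ne_zero).finrank,
        AdjoinRoot.powerBasis_dim]
    rw [← AdjoinRoot.mk_eq_zero, map_sub, map_pow, mul_comm, pow_mul, ← hcard,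
      FiniteField.pow_card_pow, sub_self]
  obtain ⟨b, hb⟩ := exists_polynomial_uniformizer_dvd_sub hπ a
  have h1 : uniformizer v π ∣ algebraMap k[X] (LocalInt v) b ^ Fintype.card k ^ (r * π.natDegree) -
      algebraMap k[X] (LocalInt v) b := by
    simpa [uniformizer] using map_dvd (algebraMap k[X] (LocalInt v)) (hpoly b)
  have h2 := hb.trans (sub_dvd_pow_sub_pow a (algebraMap k[X] (LocalInt v) b)
    (Fintype.card k ^ (r * π.natDegree)))
  have h3 := dvd_sub (dvd_add h2 h1) hb
  convert h3 using 1
  ring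

end LocalFieldFacts

/-! ### The polynomial `Φ_π` and its zeros -/

theorem charP_localInt {k : Type*} [Field k] {v : HeightOneSpectrum k[X]} (p : ℕ)
    [CharP k p] : CharP (LocalInt v) p :=
  charP_of_injective_ringHom (algebraMap k (LocalInt v)).injective p

section Additive

variable {k : Type*} [Field k] [Fintype k] {v : HeightOneSpectrum k[X]}

/-- The ring homomorphism `k → 𝐂_𝔭`. -/
noncomputable def embConst (v : HeightOneSpectrum k[X]) : k →+* Cp v :=
  (embInt v).comp (algebraMap k (LocalInt v))

theorem add_pow_card_pow_Cp (n : ℕ) (x y : Cp v) :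
    (x + y) ^ Fintype.card k ^ n = x ^ Fintype.card k ^ n + y ^ Fintype.card k ^ n := by
  obtain ⟨p, hp⟩ := CharP.exists k
  obtain ⟨m, hp', hm⟩ := FiniteField.card k p
  have : Fact p.Prime := ⟨hp'⟩
  have : CharP (Cp v) p := charP_of_injective_ringHom (embConst v).injective p
  rw [hm, ← pow_mul]
  exact add_pow_char_pow x y p _

theorem toPoly_add (F G : SkewPolynomial (LocalInt v)) :
    toPoly (F + G) = toPoly F + toPoly G :=
  SkewMonoidAlgebra.sum_add_index' (fun _ => map_zero _) fun _ _ _ => map_add _ _ _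

theorem toPoly_monomial (n : ℕ) (c : LocalInt v) :
    toPoly (SkewPolynomial.monomial n c) = Polynomial.monomial (Fintype.card k ^ n) c :=
  SkewPolynomial.sum_monomial_index (map_zero _)

theorem toPoly_zero : toPoly (0 : SkewPolynomial (LocalInt v)) = 0 := by
  have := toPoly_add (0 : SkewPolynomial (LocalInt v)) 0
  simpa using this

/-- The operator `∑ cᵢ τⁱ` evaluated at a point of `𝐂_𝔭`, additively in the operator. -/
noncomputable def operatorEval (z : Cp v) : SkewPolynomial (LocalInt v) →+ Cp v where
  toFun F := (toPoly F).eval₂ (embInt v) z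
  map_zero' := by rw [toPoly_zero, eval₂_zero]
  map_add' F G := by rw [toPoly_add, eval₂_add]

theorem operatorEval_monomial (z : Cp v) (n : ℕ) (c : LocalInt v) :
    operatorEval z (SkewPolynomial.monomial n c) = embInt v c * z ^ Fintype.card k ^ n := by
  change (toPoly _).eval₂ _ _ = _
  rw [toPoly_monomial, eval₂_monomial]

theorem operatorEval_add_right (F : SkewPolynomial (LocalInt v)) (z w : Cp v) :
    operatorEval (z + w) F = operatorEval z F + operatorEval w F := by
  have h : operatorEval (z + w) = operatorEval (v := v) z + operatorEval w := by
    refine SkewMonoidAlgebra.addHom_ext fun n c => ?_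
    change operatorEval _ (SkewPolynomial.monomial n.toAdd c) =
      operatorEval _ (SkewPolynomial.monomial n.toAdd c) +
        operatorEval _ (SkewPolynomial.monomial n.toAdd c)
    rw [operatorEval_monomial, operatorEval_monomial, operatorEval_monomial, add_pow_card_pow_Cp,
      mul_add]
  exact DFunLike.congr_fun h F

theorem operatorEval_zero_right (F : SkewPolynomial (LocalInt v)) :
    operatorEval 0 F = 0 := by
  simpa using operatorEval_add_right F 0 0

/-- Multiplication in `𝒪{τ}` is composition of operators. -/
theorem operatorEval_mul (F G : SkewPolynomial (LocalInt v)) (z : Cp v) :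
    operatorEval z (F * G) = operatorEval (operatorEval z G) F := by
  have h : (operatorEval z).comp (AddMonoidHom.mulRight G) = operatorEval (operatorEval z G) := by
    refine SkewMonoidAlgebra.addHom_ext fun n c => ?_
    have h2 : (operatorEval z).comp (AddMonoidHom.mulLeft (SkewPolynomial.monomial n.toAdd c)) =
        ((AddMonoidHom.mulLeft (embInt v c)).comp (AddMonoidHom.mk'
          (fun x : Cp v => x ^ Fintype.card k ^ n.toAdd) (add_pow_card_pow_Cp _))).comp
          (operatorEval z) := by
      refine SkewMonoidAlgebra.addHom_ext fun m b => ?_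
      change operatorEval z (SkewPolynomial.monomial n.toAdd c *
        SkewPolynomial.monomial m.toAdd b) = embInt v c *
          (operatorEval z (SkewPolynomial.monomial m.toAdd b)) ^ Fintype.card k ^ n.toAdd
      rw [SkewPolynomial.monomial_mul_monomial, SkewPolynomial.φ_iterate_apply,
        operatorEval_monomial, operatorEval_monomial]
      change embInt v (c * b ^ Fintype.card k ^ n.toAdd) * _ = _
      rw [map_mul, map_pow, mul_pow, ← pow_mul, ← pow_add, add_comm, mul_assoc]
    have h3 := DFunLike.congr_fun h2 G
    refine h3.trans ?_
    exact (operatorEval_monomial _ n.toAdd c).symm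
  exact DFunLike.congr_fun h F

theorem toPoly_eq_sum {F : SkewPolynomial (LocalInt v)} {N : ℕ} (h : ∀ i, N < i → F.coeff i = 0) :
    toPoly F = ∑ i ∈ Finset.range (N + 1),
      Polynomial.monomial (Fintype.card k ^ i) (F.coeff i) := by
  rw [toPoly, SkewPolynomial.sum_def]
  refine Finset.sum_subset (fun i hi => ?_) fun i _ hi => ?_
  · rw [SkewPolynomial.mem_support_iff] at hi
    rw [Finset.mem_range]
    by_contra hlt
    exact hi (h i (by omega))
  · rw [SkewPolynomial.notMem_support_iff.mp hi, map_zero]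

end Additive

section TorsionPolynomial

variable {k : Type*} [Field k] [Fintype k] {v : HeightOneSpectrum k[X]}

theorem prime_pow_pos (p e : ℕ) [hp : Fact p.Prime] : 0 < p ^ e := Nat.pow_pos hp.out.pos

/-- The properties of the polynomial `Φ_π` on which the construction of the norm operator rests:
it is an additive distinguished polynomial, congruent to `X ^ Q` with `Q = p ^ e` a power of the
cardinality of the residue field, and its zeros form the finite set `W` and are simple. -/
structure IsTorsionPolynomial (π : k[X]) (p e : ℕ) (P : (LocalInt v)[X]) (W : Finset (Cp v)) :
    Prop where
  natDegree_eq : P.natDegree = p ^ e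
  one_le : 1 ≤ e
  distinguished : P.IsDistinguishedAt (IsLocalRing.maximalIdeal (LocalInt v))
  coeff_zero : P.coeff 0 = 0
  dvd_sub : C (uniformizer v π) ∣ P - X ^ p ^ e
  dvd_pow_sub : ∀ a : LocalInt v, uniformizer v π ∣ a ^ p ^ e - a
  eval_add : ∀ z w : Cp v, P.eval₂ (embInt v) (z + w) =
    P.eval₂ (embInt v) z + P.eval₂ (embInt v) w
  map_eq : P.map (embInt v) = ∏ u ∈ W, (X - C u)

theorem map_embInt_splits (P : (LocalInt v)[X]) : (P.map (embInt v)).Splits := by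
  have h : embInt v = (algebraMap (LocalAlgCl v) (Cp v)).comp
      ((algebraMap (LocalField v) (LocalAlgCl v)).comp
        (v.adicCompletionIntegers (RatFunc k)).subtype) := rfl
  rw [h, ← Polynomial.map_map]
  exact (IsAlgClosed.splits _).map _

/-- Maximal height and monicity say that `Φ_π` is congruent to `X ^ Q`. Its zeros are simple, its
derivative being the constant `π`, and they form `Φ[𝔭]`, as `Φ_(bπ) = Φ_b ∘ Φ_π`. -/
theorem exists_isTorsionPolynomial {π : k[X]} (hπ : v.asIdeal = Ideal.span {π})
    (Φ : DrinfeldModule v) {r : ℕ} (hr : 0 < r) (hrank : Φ.HasRank r) (hheight : Φ.HasHeight π r)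
    (hmonic : (Φ.poly π).Monic) (p : ℕ) [Fact p.Prime] [CharP k p] :
    ∃ (e : ℕ) (W : Finset (Cp v)), IsTorsionPolynomial π p e (Φ.poly π) W ∧ Φ.torsion = W := by
  classical
  have hirr := irreducible_of_asIdeal_eq hπ
  obtain ⟨N, hN⟩ : ∃ N, N = r * π.natDegree := ⟨_, rfl⟩
  have hN0 : N ≠ 0 := hN ▸ (Nat.mul_pos hr hirr.natDegree_pos).ne'
  obtain ⟨m, -, hm⟩ := FiniteField.card k p
  have hq : 1 < Fintype.card k := Fintype.one_lt_card
  have hinj : Function.Injective fun i : ℕ => Fintype.card k ^ i := Nat.pow_right_injective hq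
  have hsum : Φ.poly π = ∑ i ∈ Finset.range (N + 1),
      Polynomial.monomial (Fintype.card k ^ i) (Φ.coeff π i) :=
    toPoly_eq_sum (hN ▸ (hrank π hirr.ne_zero).2)
  have hcoeff : ∀ i ∈ Finset.range (N + 1),
      (Φ.poly π).coeff (Fintype.card k ^ i) = Φ.coeff π i := by
    intro i hi
    rw [hsum, finsetSum_coeff, Finset.sum_eq_single i]
    · simp
    · intro j _ hj
      rw [coeff_monomial, if_neg fun h => hj (hinj h)]
    · exact fun h => absurd hi h
  have hdegle : (Φ.poly π).natDegree ≤ Fintype.card k ^ N := by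
    rw [hsum]
    refine natDegree_sum_le_of_forall_le _ _ fun i hi => (natDegree_monomial_le _).trans ?_
    exact Nat.pow_le_pow_right hq.le (by rw [Finset.mem_range] at hi; omega)
  have hdeg : (Φ.poly π).natDegree = Fintype.card k ^ N := by
    refine le_antisymm hdegle (le_natDegree_of_ne_zero ?_)
    rw [hcoeff N (by simp)]
    exact hN ▸ (hrank π hirr.ne_zero).1
  have hmem : ∀ j < Fintype.card k ^ N,
      (Φ.poly π).coeff j ∈ IsLocalRing.maximalIdeal (LocalInt v) := by
    intro j hj
    rw [hsum, finsetSum_coeff]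
    refine Ideal.sum_mem _ fun i hi => ?_
    rw [coeff_monomial]
    split_ifs with hij
    · rw [← IsLocalRing.residue_eq_zero_iff]
      refine hheight.2 i (hN ▸ ?_)
      rw [← hij] at hj
      exact (Nat.pow_lt_pow_iff_right hq).mp hj
    · exact Ideal.zero_mem _
  have hdist : (Φ.poly π).IsDistinguishedAt (IsLocalRing.maximalIdeal (LocalInt v)) :=
    ⟨⟨fun {j} hj => hmem j (by rwa [hdeg] at hj)⟩, hmonic⟩
  have hderiv : derivative (Φ.poly π) = C (uniformizer v π) := by
    rw [hsum, derivative_sum, Finset.sum_eq_single 0]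
    · rw [derivative_monomial, pow_zero, Nat.cast_one, mul_one, Nat.sub_self]
      exact congrArg C (Φ.coeff_zero π)
    · intro i _ hi
      have hchar : CharP (LocalInt v) p := charP_localInt p
      have hz : ((Fintype.card k ^ i : ℕ) : LocalInt v) = 0 := by
        rw [CharP.cast_eq_zero_iff (LocalInt v) p, hm, ← pow_mul]
        exact dvd_pow_self p (Nat.mul_ne_zero m.ne_zero hi)
      rw [derivative_monomial, hz, mul_zero, map_zero]
    · simp
  have hsep : ((Φ.poly π).map (embInt v)).Separable := by
    have hu : embInt v (uniformizer v π) ≠ 0 :=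
      (map_ne_zero_iff _ embInt_injective).mpr (uniformizer_ne_zero hπ)
    refine ⟨0, C (embInt v (uniformizer v π))⁻¹, ?_⟩
    rw [derivative_map, hderiv, map_C, ← C_mul, inv_mul_cancel₀ hu]
    simp
  have hroots : (Φ.poly π).map (embInt v) =
      ∏ u ∈ ((Φ.poly π).map (embInt v)).roots.toFinset, (X - C u) := by
    conv_lhs => rw [(map_embInt_splits (Φ.poly π)).eq_prod_roots_of_monic (hmonic.map _)]
    rw [Finset.prod, Multiset.toFinset_val, (nodup_roots hsep).dedup]
  have hQ : Fintype.card k ^ N = p ^ (m * N) := by rw [hm, pow_mul]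
  refine ⟨m * N, ((Φ.poly π).map (embInt v)).roots.toFinset, ⟨?_, ?_, hdist, ?_, ?_, ?_, ?_,
    hroots⟩, ?_⟩
  · rw [hdeg, hQ]
  · exact Nat.mul_pos m.pos (Nat.pos_of_ne_zero hN0)
  · rw [hsum, finsetSum_coeff]
    refine Finset.sum_eq_zero fun i _ => ?_
    rw [coeff_monomial, if_neg (pow_ne_zero i (by omega))]
  · rw [C_dvd_iff_dvd_coeff]
    intro j
    rw [← Ideal.mem_span_singleton, ← maximalIdeal_eq_span_uniformizer hπ, coeff_sub, coeff_X_pow,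
      ← hQ]
    split_ifs with hj
    · have : (Φ.poly π).coeff j = 1 := by rw [hj, ← hdeg]; exact hmonic
      rw [this, sub_self]
      exact Ideal.zero_mem _
    · rw [sub_zero]
      rcases lt_or_gt_of_ne hj with hlt | hgt
      · exact hmem j hlt
      · rw [coeff_eq_zero_of_natDegree_lt (by rwa [hdeg])]
        exact Ideal.zero_mem _
  · rw [← hQ, hN]
    exact uniformizer_dvd_pow_sub_self hπ r
  · exact operatorEval_add_right (Φ.toRingHom π)
  · ext u
    rw [Finset.mem_coe, Multiset.mem_toFinset, mem_roots (hmonic.map _).ne_zero, IsRoot.def,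
      eval_map]
    constructor
    · intro hu
      exact hu π (by rw [hπ]; exact Ideal.mem_span_singleton_self π)
    · intro hu a ha
      rw [hπ, Ideal.mem_span_singleton] at ha
      obtain ⟨b, rfl⟩ := ha
      change operatorEval u (Φ.toRingHom (π * b)) = 0
      rw [mul_comm, map_mul, operatorEval_mul]
      have h1 : operatorEval u (Φ.toRingHom π) = 0 := hu
      rw [h1, operatorEval_zero_right]

variable {π : k[X]} {p e : ℕ} {P : (LocalInt v)[X]} {W : Finset (Cp v)}

namespace IsTorsionPolynomial

variable (hP : IsTorsionPolynomial π p e P W)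
include hP

theorem eval_eq_prod (z : Cp v) : P.eval₂ (embInt v) z = ∏ u ∈ W, (z - u) := by
  rw [← eval_map, hP.map_eq, eval_prod]
  simp

theorem card_eq : W.card = p ^ e := by
  rw [← hP.natDegree_eq, ← natDegree_map_eq_of_injective embInt_injective, hP.map_eq,
    natDegree_finsetProd_X_sub_C_eq_card]

theorem eval_eq_zero_iff (z : Cp v) : P.eval₂ (embInt v) z = 0 ↔ z ∈ W := by
  rw [hP.eval_eq_prod, Finset.prod_eq_zero_iff]
  constructor
  · rintro ⟨u, hu, h⟩
    rwa [sub_eq_zero.mp h]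
  · exact fun h => ⟨z, h, sub_self z⟩

theorem eval_zero : P.eval₂ (embInt v) 0 = 0 := by
  simpa using hP.eval_add 0 0

theorem zero_mem : (0 : Cp v) ∈ W := (hP.eval_eq_zero_iff 0).mp hP.eval_zero

theorem eval_add_of_mem (z : Cp v) {u : Cp v} (hu : u ∈ W) :
    P.eval₂ (embInt v) (z + u) = P.eval₂ (embInt v) z := by
  rw [hP.eval_add, (hP.eval_eq_zero_iff u).mpr hu, add_zero]

theorem eval_neg (z : Cp v) : P.eval₂ (embInt v) (-z) = -P.eval₂ (embInt v) z := by
  have := hP.eval_add z (-z)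
  rw [add_neg_cancel, hP.eval_zero] at this
  exact (neg_eq_of_add_eq_zero_right this.symm).symm

theorem neg_mem {u : Cp v} (hu : u ∈ W) : -u ∈ W := by
  rw [← hP.eval_eq_zero_iff, hP.eval_neg, (hP.eval_eq_zero_iff u).mpr hu, neg_zero]

theorem eval_sub (z w : Cp v) : P.eval₂ (embInt v) (z - w) =
    P.eval₂ (embInt v) z - P.eval₂ (embInt v) w := by
  rw [sub_eq_add_neg, hP.eval_add, hP.eval_neg, sub_eq_add_neg]

theorem eval_eq_prod_add (z : Cp v) : P.eval₂ (embInt v) z = ∏ u ∈ W, (z + u) := by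
  rw [hP.eval_eq_prod]
  exact Finset.prod_bij' (fun u _ => -u) (fun u _ => -u) (fun _ => hP.neg_mem)
    (fun _ => hP.neg_mem) (by simp) (by simp) (by simp [sub_eq_add_neg])

theorem exists_eval_eq [Fact p.Prime] : ∃ G : (LocalInt v)[X], G.natDegree ≤ p ^ e ∧
    ∀ z : Cp v, P.eval₂ (embInt v) z =
      z ^ p ^ e + embInt v (uniformizer v π) * G.eval₂ (embInt v) z := by
  obtain ⟨G, hG⟩ := hP.dvd_sub
  by_cases hu : uniformizer v π = 0
  · refine ⟨0, by simp, fun z => ?_⟩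
    rw [hu, map_zero, zero_mul] at hG
    rw [sub_eq_zero.mp hG]
    simp
  refine ⟨G, ?_, fun z => ?_⟩
  · rw [← natDegree_C_mul hu, ← hG]
    exact (natDegree_sub_le _ _).trans (max_le hP.natDegree_eq.le (by simp))
  · rw [eq_add_of_sub_eq' hG]
    simp

end IsTorsionPolynomial

theorem norm_eval₂_le_max_pow (G : (LocalInt v)[X]) {n : ℕ} (hn : G.natDegree ≤ n) (z : Cp v) :
    ‖G.eval₂ (embInt v) z‖ ≤ max ‖z‖ 1 ^ n := by
  rw [eval₂_eq_sum_range]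
  refine IsUltrametricDist.norm_sum_le_of_forall_le_of_nonneg (by positivity) fun i hi => ?_
  rw [norm_mul, norm_pow]
  have hin : i ≤ n := by rw [Finset.mem_range] at hi; omega
  calc _ ≤ 1 * max ‖z‖ 1 ^ i := mul_le_mul (norm_embInt_le_one _)
        (pow_le_pow_left₀ (norm_nonneg _) (le_max_left _ _) i) (by positivity) zero_le_one
    _ ≤ _ := by rw [one_mul]; exact pow_le_pow_right₀ (le_max_right _ _) hin

namespace IsTorsionPolynomial

variable (hπ : v.asIdeal = Ideal.span {π}) [Fact p.Prime] (hP : IsTorsionPolynomial π p e P W)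
include hπ hP

theorem norm_eval_of_one_le {z : Cp v} (hz : 1 ≤ ‖z‖) :
    ‖P.eval₂ (embInt v) z‖ = ‖z‖ ^ p ^ e := by
  obtain ⟨G, hG, h⟩ := hP.exists_eval_eq
  have h1 := norm_eval₂_le_max_pow G hG z
  rw [max_eq_left hz] at h1
  have h2 : ‖embInt v (uniformizer v π) * G.eval₂ (embInt v) z‖ < ‖z ^ p ^ e‖ := by
    rw [norm_mul, norm_pow]
    calc _ ≤ ‖embInt v (uniformizer v π)‖ * ‖z‖ ^ p ^ e :=
          mul_le_mul_of_nonneg_left h1 (norm_nonneg _)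
      _ < 1 * ‖z‖ ^ p ^ e :=
          mul_lt_mul_of_pos_right (norm_uniformizer_lt_one hπ) (by positivity)
      _ = _ := one_mul _
  rw [h, IsUltrametricDist.norm_add_eq_max_of_norm_ne_norm h2.ne', max_eq_left h2.le, norm_pow]

theorem norm_lt_one_of_mem {u : Cp v} (hu : u ∈ W) : ‖u‖ < 1 := by
  by_contra h
  have h1 := hP.norm_eval_of_one_le hπ (not_lt.mp h)
  rw [(hP.eval_eq_zero_iff u).mpr hu, norm_zero] at h1
  have : 0 < ‖u‖ := zero_lt_one.trans_le (not_lt.mp h)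
  exact (pow_ne_zero _ this.ne') h1.symm

theorem norm_lt_one_of_norm_eval_lt_one {z : Cp v} (hz : ‖P.eval₂ (embInt v) z‖ < 1) :
    ‖z‖ < 1 := by
  by_contra h
  rw [hP.norm_eval_of_one_le hπ (not_lt.mp h)] at hz
  exact absurd (one_le_pow₀ (not_lt.mp h)) (not_le.mpr hz)

theorem norm_eval_lt_one {z : Cp v} (hz : ‖z‖ < 1) : ‖P.eval₂ (embInt v) z‖ < 1 := by
  obtain ⟨G, hG, h⟩ := hP.exists_eval_eq
  have h1 := norm_eval₂_le_max_pow G hG z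
  rw [max_eq_right hz.le, one_pow] at h1
  rw [h]
  refine (IsUltrametricDist.norm_add_le_max _ _).trans_lt (max_lt ?_ ?_)
  · rw [norm_pow]
    exact pow_lt_one₀ (norm_nonneg _) hz (prime_pow_pos p e).ne'
  · rw [norm_mul]
    exact (mul_le_of_le_one_right (norm_nonneg _) h1).trans_lt (norm_uniformizer_lt_one hπ)

omit hπ [Fact p.Prime] in
/-- Every value of `P` is taken at a point that is as small as the value permits, since the
product over a fibre is the value, up to sign. -/
theorem exists_eval_eq_norm_pow_le (z : Cp v) :
    ∃ y, P.eval₂ (embInt v) y = P.eval₂ (embInt v) z ∧ ‖y‖ ^ p ^ e ≤ ‖P.eval₂ (embInt v) z‖ := by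
  obtain ⟨u, hu, hmin⟩ := W.exists_min_image (fun u => ‖z + u‖) ⟨0, hP.zero_mem⟩
  refine ⟨z + u, hP.eval_add_of_mem z hu, ?_⟩
  rw [hP.eval_eq_prod_add z, norm_prod, ← hP.card_eq, ← Finset.prod_const]
  exact Finset.prod_le_prod (fun _ _ => norm_nonneg _) fun w hw => hmin w hw

omit hπ in
theorem exists_eval_eq_coe (w : LocalAlgCl v) : ∃ z : Cp v, P.eval₂ (embInt v) z = w := by
  let j : LocalInt v →+* LocalAlgCl v := (algebraMap (LocalField v) (LocalAlgCl v)).comp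
    (v.adicCompletionIntegers (RatFunc k)).subtype
  have hj : Function.Injective j :=
    (algebraMap (LocalField v) (LocalAlgCl v)).injective.comp Subtype.val_injective
  have hdeg : (P.map j - C w).degree ≠ 0 := by
    have h1 : (P.map j).natDegree = p ^ e := by
      rw [natDegree_map_eq_of_injective hj, hP.natDegree_eq]
    have h2 : (P.map j - C w).natDegree ≠ 0 := by
      rw [natDegree_sub_C, h1]
      exact (prime_pow_pos p e).ne'
    exact fun h => h2 (natDegree_eq_of_degree_eq_some h)
  obtain ⟨y, hy⟩ := IsAlgClosed.exists_root _ hdeg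
  refine ⟨algebraMap (LocalAlgCl v) (Cp v) y, ?_⟩
  rw [IsRoot.def, Polynomial.eval_sub, eval_C, eval_map, sub_eq_zero] at hy
  change P.eval₂ ((algebraMap (LocalAlgCl v) (Cp v)).comp j) _ = algebraMap (LocalAlgCl v) (Cp v) w
  rw [← hom_eval₂, hy]

omit hπ in
/-- `P` is surjective on `𝐂_𝔭`: a point is a sum of a null sequence of values of `P`, and
preimages of these values can be chosen to form a null sequence as well. -/
theorem surjective_eval (w : Cp v) : ∃ z : Cp v, P.eval₂ (embInt v) z = w := by
  obtain ⟨δ, hδ, hlim⟩ := mem_closure_iff_seq_limit.mp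
    (UniformSpace.Completion.denseRange_coe (α := LocalAlgCl v) w)
  have hrange : ∀ n, ∃ z, P.eval₂ (embInt v) z = δ n := fun n => by
    obtain ⟨a, ha⟩ := hδ n
    rw [← ha]
    exact hP.exists_eval_eq_coe a
  have hdiff : ∀ n, ∃ y, P.eval₂ (embInt v) y = δ (n + 1) - δ n ∧
      ‖y‖ ^ p ^ e ≤ ‖δ (n + 1) - δ n‖ := fun n => by
    obtain ⟨z, hz⟩ := hrange n
    obtain ⟨z', hz'⟩ := hrange (n + 1)
    have := hP.exists_eval_eq_norm_pow_le (z' - z)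
    rwa [hP.eval_sub, hz, hz'] at this
  choose y hy hyn using hdiff
  obtain ⟨z₀, hz₀⟩ := hrange 0
  have hd : Tendsto (fun n => ‖δ (n + 1) - δ n‖) atTop (𝓝 0) := by
    have := (((tendsto_add_atTop_iff_nat 1).mpr hlim).sub hlim).norm
    simpa using this
  have hy0 : Tendsto y atTop (𝓝 0) := by
    rw [Metric.tendsto_atTop]
    intro ε hε
    obtain ⟨n₀, hn₀⟩ := (Metric.tendsto_atTop.mp hd) (ε ^ p ^ e) (by positivity)
    refine ⟨n₀, fun n hn => ?_⟩
    rw [dist_zero_right]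
    refine lt_of_pow_lt_pow_left₀ (p ^ e) hε.le ((hyn n).trans_lt ?_)
    simpa using hn₀ n hn
  have hsum : Summable y := NonarchimedeanAddGroup.summable_of_tendsto_cofinite_zero
    (by rwa [Nat.cofinite_eq_atTop])
  have hpart : ∀ n, P.eval₂ (embInt v) (z₀ + ∑ i ∈ Finset.range n, y i) = δ n := by
    intro n
    induction n with
    | zero => simpa using hz₀
    | succ n ih => rw [Finset.sum_range_succ, ← add_assoc, hP.eval_add, ih, hy]; ring
  have hcont : Continuous fun z : Cp v => P.eval₂ (embInt v) z := P.continuous_eval₂ _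
  refine ⟨z₀ + ∑' i, y i, tendsto_nhds_unique ?_ hlim⟩
  have := (hcont.tendsto (z₀ + ∑' i, y i)).comp (hsum.hasSum.tendsto_sum_nat.const_add z₀)
  exact this.congr hpart

omit hπ [Fact p.Prime] in
/-- The preimage of a circle under `P` lies on finitely many circles: away from the norms of the
zeros, `‖P z‖` is a strictly increasing function of `‖z‖`. -/
theorem finite_norms_of_norm_eval_eq {σ : ℝ} (hσ : 0 < σ) :
    {ρ : ℝ | ∃ z : Cp v, ‖P.eval₂ (embInt v) z‖ = σ ∧ ‖z‖ = ρ}.Finite := by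
  have hfin : ((W.image norm : Finset ℝ) : Set ℝ).Finite := Finset.finite_toSet _
  have hsub : {t : ℝ | 0 < t ∧ ∏ u ∈ W, max t ‖u‖ = σ}.Subsingleton := by
    have hlt : ∀ s t : ℝ, 0 < s → s < t → ∏ u ∈ W, max s ‖u‖ < ∏ u ∈ W, max t ‖u‖ := by
      intro s t hs hst
      refine Finset.prod_lt_prod (fun u _ => lt_max_of_lt_left hs)
        (fun u _ => max_le_max_right _ hst.le) ⟨0, hP.zero_mem, ?_⟩
      rw [norm_zero, max_eq_left hs.le, max_eq_left (hs.trans hst).le]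
      exact hst
    rintro s ⟨hs, hs'⟩ t ⟨ht, ht'⟩
    rcases lt_trichotomy s t with h | h | h
    · exact absurd (hlt s t hs h) (by rw [hs', ht']; exact lt_irrefl _)
    · exact h
    · exact absurd (hlt t s ht h) (by rw [hs', ht']; exact lt_irrefl _)
  refine (hfin.union hsub.finite).subset ?_
  rintro _ ⟨z, hz, rfl⟩
  by_cases hmem : ‖z‖ ∈ W.image norm
  · exact Or.inl hmem
  refine Or.inr ⟨?_, ?_⟩
  · rw [norm_pos_iff]
    rintro rfl
    rw [hP.eval_zero, norm_zero] at hz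
    exact hσ.ne hz
  · rw [← hz, hP.eval_eq_prod, norm_prod]
    refine Finset.prod_congr rfl fun u hu => ?_
    rw [sub_eq_add_neg, IsUltrametricDist.norm_add_eq_max_of_norm_ne_norm, norm_neg]
    intro h
    rw [norm_neg] at h
    exact hmem (h ▸ Finset.mem_image_of_mem _ hu)

end IsTorsionPolynomial

end TorsionPolynomial

/-! ### Evaluation of convergent Laurent series -/

theorem hasSum_of_hasSum_fiber {E : Type*} [AddCommGroup E] [TopologicalSpace E] [RegularSpace E]
    [ContinuousAdd E] {F : ℤ × ℤ → E} {G : ℤ → E} {s : E} (h : HasSum F s)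
    (hG : ∀ n, HasSum (fun p : {p : ℤ × ℤ // p.1 + p.2 = n} => F p.1) (G n)) : HasSum G s :=
  HasSum.sigma ((Equiv.sigmaFiberEquiv (fun p : ℤ × ℤ => p.1 + p.2)).hasSum_iff.mpr h) hG

/-- The Cauchy product of two series indexed by `ℤ`, when each antidiagonal is supported on a
finite set `t n`. -/
theorem hasSum_cauchyProduct {E : Type*} [NormedField E] [NonarchimedeanRing E] {A B G : ℤ → E}
    {a b : E} (hA : HasSum A a) (hB : HasSum B b) (t : ℤ → Finset (ℤ × ℤ))
    (ht : ∀ n, ∀ p ∈ t n, p.1 + p.2 = n) (ht' : ∀ p, p ∉ t (p.1 + p.2) → A p.1 * B p.2 = 0)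
    (hG : ∀ n, G n = ∑ p ∈ t n, A p.1 * B p.2) : HasSum G (a * b) := by
  refine hasSum_of_hasSum_fiber (hA.mul_of_nonarchimedean hB) fun n => ?_
  have hind : ∑ p ∈ t n, A p.1 * B p.2 = ∑ p ∈ t n,
      Set.indicator {p : ℤ × ℤ | p.1 + p.2 = n} (fun p => A p.1 * B p.2) p :=
    Finset.sum_congr rfl fun p hp =>
      (Set.indicator_of_mem (s := {p : ℤ × ℤ | p.1 + p.2 = n}) (ht n p hp)
        (fun p => A p.1 * B p.2)).symm
  rw [hG, hind]
  refine (hasSum_subtype_iff_indicator (f := fun p : ℤ × ℤ => A p.1 * B p.2)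
    (s := {p : ℤ × ℤ | p.1 + p.2 = n})).mpr ?_
  refine hasSum_sum_of_ne_finset_zero fun p hp => ?_
  by_cases hn : p.1 + p.2 = n
  · rw [Set.indicator_of_mem (by exact hn)]
    exact ht' p (by rwa [hn])
  · exact Set.indicator_of_notMem (by exact hn) _

theorem hasSum_coeff_mul {E : Type*} [NormedField E] [NonarchimedeanRing E]
    {f g : LaurentSeries E} {z a b : E} (h0 : z ≠ 0)
    (hf : HasSum (fun n : ℤ => f.coeff n * z ^ n) a)
    (hg : HasSum (fun n : ℤ => g.coeff n * z ^ n) b) :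
    HasSum (fun n : ℤ => (f * g).coeff n * z ^ n) (a * b) := by
  refine hasSum_cauchyProduct hf hg
    (fun n => Finset.antidiagonal f.isPWO_support g.isPWO_support n)
    (fun n p hp => (Finset.mem_antidiagonal.mp hp).2.2) (fun p hp => ?_) fun n => ?_
  · by_contra hne
    exact hp (Finset.mem_antidiagonal.mpr ⟨left_ne_zero_of_mul (left_ne_zero_of_mul hne),
      left_ne_zero_of_mul (right_ne_zero_of_mul hne), rfl⟩)
  · rw [HahnSeries.coeff_mul, Finset.sum_mul]
    refine Finset.sum_congr rfl fun p hp => ?_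
    rw [← (Finset.mem_antidiagonal.mp hp).2.2, zpow_add₀ h0]
    ring

section Evaluation

variable {k : Type*} [Field k] [Fintype k] {v : HeightOneSpectrum k[X]} {R : Subring (Cp v)}

theorem ConvergentLaurent.summable (f : ConvergentLaurent R) (z : PuncturedBall v) :
    Summable fun n : ℤ => f.1.coeff n * z.1 ^ n :=
  f.2.2 z.1 z.2.1 z.2.2

theorem PuncturedBall.ne_zero (z : PuncturedBall v) : z.1 ≠ 0 := norm_pos_iff.mp z.2.1

/-- Evaluation of convergent Laurent series at a point of the punctured open unit ball. -/
noncomputable def evalHom (R : Subring (Cp v)) (z : PuncturedBall v) :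
    ConvergentLaurent R →+* Cp v where
  toFun f := f.eval z.1
  map_zero' := by
    change ∑' n : ℤ, (0 : LaurentSeries (Cp v)).coeff n * z.1 ^ n = 0
    simp
  map_one' := by
    change ∑' n : ℤ, (1 : LaurentSeries (Cp v)).coeff n * z.1 ^ n = 1
    rw [tsum_eq_single 0]
    · simp
    · intro n hn
      rw [HahnSeries.coeff_one, if_neg hn, zero_mul]
  map_add' f g := by
    change ∑' n : ℤ, (f.1 + g.1).coeff n * z.1 ^ n = _
    simp only [HahnSeries.coeff_add, add_mul]
    exact (f.summable z).tsum_add (g.summable z)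
  map_mul' f g :=
    (hasSum_coeff_mul z.ne_zero (f.summable z).hasSum (g.summable z).hasSum).tsum_eq

theorem evalHom_unit_ne_zero (z : PuncturedBall v) (g : (ConvergentLaurent R)ˣ) :
    evalHom R z g ≠ 0 := (g.isUnit.map (evalHom R z)).ne_zero

theorem evalHom_inclOK (z : PuncturedBall v) (f : ConvergentLaurent (subO v)) :
    evalHom (subK v) z (inclOK v f) = evalHom (subO v) z f := rfl

theorem inclOK_injective : Function.Injective (inclOK v) := fun _ _ h =>
  Subtype.ext (congrArg (fun f : ConvergentLaurent (subK v) => f.1) h)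

/-- The image in `𝐂_𝔭((x))` of a power series over `𝒪`. -/
noncomputable def embSeries (v : HeightOneSpectrum k[X]) :
    PowerSeries (LocalInt v) →+* LaurentSeries (Cp v) :=
  (HahnSeries.ofPowerSeries ℤ (Cp v)).comp (PowerSeries.map (embInt v))

theorem coeff_embSeries (f : PowerSeries (LocalInt v)) (n : ℤ) :
    (embSeries v f).coeff n = if n < 0 then 0 else embInt v (PowerSeries.coeff n.natAbs f) := by
  rw [embSeries, RingHom.comp_apply, PowerSeries.coeff_coe, PowerSeries.coeff_map]

theorem coeff_embSeries_mul_zpow_eq_zero (f : PowerSeries (LocalInt v)) (z : Cp v) (n : ℤ)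
    (hn : n ∉ Set.range ((↑) : ℕ → ℤ)) : (embSeries v f).coeff n * z ^ n = 0 := by
  rw [coeff_embSeries, if_pos, zero_mul]
  by_contra h
  exact hn ⟨n.toNat, Int.toNat_of_nonneg (not_lt.mp h)⟩

theorem convergesOnBall_embSeries (f : PowerSeries (LocalInt v)) :
    ConvergesOnBall (embSeries v f) := by
  intro z _ hz
  refine (Nat.cast_injective.summable_iff (coeff_embSeries_mul_zpow_eq_zero f z)).mp ?_
  refine Summable.of_norm_bounded (summable_geometric_of_lt_one (norm_nonneg z) hz) fun n => ?_
  rw [Function.comp_apply, coeff_embSeries, if_neg (by omega), norm_mul, zpow_natCast, norm_pow]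
  exact mul_le_of_le_one_left (by positivity) (norm_embInt_le_one _)

/-- The inclusion `𝒪⟦x⟧ → 𝒪((x))₁`. -/
noncomputable def seriesHom (v : HeightOneSpectrum k[X]) :
    PowerSeries (LocalInt v) →+* ConvergentLaurent (subO v) :=
  (embSeries v).codRestrict (convergentLaurentSubring (subO v)) fun f =>
    ⟨fun n => by
      rw [coeff_embSeries]
      split_ifs
      exacts [Subring.zero_mem _, ⟨_, rfl⟩], convergesOnBall_embSeries f⟩

theorem seriesHom_injective : Function.Injective (seriesHom v) := by
  intro f g h
  have h1 : embSeries v f = embSeries v g := congrArg Subtype.val h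
  exact PowerSeries.map_injective _ embInt_injective
    (HahnSeries.ofPowerSeries_injective (Γ := ℤ) h1)

/-- Evaluation of a power series over `𝒪` at a point of the punctured open unit ball. -/
noncomputable def seriesEval (z : PuncturedBall v) : PowerSeries (LocalInt v) →+* Cp v :=
  (evalHom (subO v) z).comp (seriesHom v)

theorem seriesEval_eq_tsum (z : PuncturedBall v) (f : PowerSeries (LocalInt v)) :
    seriesEval z f = ∑' n : ℕ, embInt v (PowerSeries.coeff n f) * z.1 ^ n := by
  have h := (Nat.cast_injective (R := ℤ)).tsum_eq (f := fun n : ℤ =>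
    (embSeries v f).coeff n * z.1 ^ n) (Function.support_subset_iff'.mpr
      (coeff_embSeries_mul_zpow_eq_zero f z.1))
  refine h.symm.trans (tsum_congr fun n => ?_)
  rw [coeff_embSeries, if_neg (by omega), zpow_natCast, Int.natAbs_natCast]

theorem norm_seriesEval_le_one (z : PuncturedBall v) (f : PowerSeries (LocalInt v)) :
    ‖seriesEval z f‖ ≤ 1 := by
  rw [seriesEval_eq_tsum]
  refine IsUltrametricDist.norm_tsum_le_of_forall_le_of_nonneg zero_le_one fun n => ?_
  rw [norm_mul, norm_pow]
  exact mul_le_one₀ (norm_embInt_le_one _) (by positivity)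
    (pow_le_one₀ (norm_nonneg _) z.2.2.le)

theorem norm_seriesEval_unit (z : PuncturedBall v) (f : (PowerSeries (LocalInt v))ˣ) :
    ‖seriesEval z f‖ = 1 := by
  refine le_antisymm (norm_seriesEval_le_one z _) ?_
  have h : ‖seriesEval z f‖ * ‖seriesEval z (f⁻¹ : (PowerSeries (LocalInt v))ˣ)‖ = 1 := by
    rw [← norm_mul, ← map_mul, Units.mul_inv, map_one, norm_one]
  have := mul_le_mul_of_nonneg_left (norm_seriesEval_le_one z
    ((f⁻¹ : (PowerSeries (LocalInt v))ˣ) : PowerSeries (LocalInt v)))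
    (norm_nonneg (seriesEval z f))
  linarith

theorem seriesEval_C (z : PuncturedBall v) (a : LocalInt v) :
    seriesEval z (PowerSeries.C a) = embInt v a := by
  rw [seriesEval_eq_tsum, tsum_eq_single 0]
  · simp
  · intro n hn
    simp [PowerSeries.coeff_C, hn]

theorem seriesEval_X (z : PuncturedBall v) :
    seriesEval z (PowerSeries.X : PowerSeries (LocalInt v)) = z.1 := by
  rw [seriesEval_eq_tsum, tsum_eq_single 1]
  · simp
  · intro n hn
    simp [PowerSeries.coeff_X, hn]

theorem seriesEval_coe (z : PuncturedBall v) (T : (LocalInt v)[X]) :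
    seriesEval z (T : PowerSeries (LocalInt v)) = T.eval₂ (embInt v) z.1 := by
  have h : (seriesEval z).comp (Polynomial.coeToPowerSeries.ringHom) =
      Polynomial.eval₂RingHom (embInt v) z.1 := by
    refine Polynomial.ringHom_ext (fun a => ?_) ?_
    · simp [seriesEval_C]
    · simp [seriesEval_X]
  exact DFunLike.congr_fun h T

/-- Substitution of a polynomial is compatible with evaluation. The two sides agree on
polynomials, and up to `‖w‖ ^ n` on series that are congruent modulo `X ^ n`. -/
theorem seriesEval_compHom {P : (LocalInt v)[X]} (h0 : P.coeff 0 = 0) {z w : PuncturedBall v}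
    (hw : w.1 = P.eval₂ (embInt v) z.1) (h : PowerSeries (LocalInt v)) :
    seriesEval z (compHom P h0 h) = seriesEval w h := by
  have hpoly : ∀ T : (LocalInt v)[X], seriesEval z (compHom P h0 (T : PowerSeries (LocalInt v))) =
      seriesEval w (T : PowerSeries (LocalInt v)) := by
    intro T
    have h : ((seriesEval z).comp (compHom P h0)).comp (Polynomial.coeToPowerSeries.ringHom) =
        (seriesEval w).comp (Polynomial.coeToPowerSeries.ringHom) := by
      refine Polynomial.ringHom_ext (fun a => ?_) ?_
      · simp [seriesEval_C, compHom_C]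
      · simp [seriesEval_X, compHom_X, seriesEval_coe, hw]
    exact DFunLike.congr_fun h T
  have hbound : ∀ n : ℕ, ‖seriesEval z (compHom P h0 h) - seriesEval w h‖ ≤ ‖w.1‖ ^ n := by
    intro n
    obtain ⟨g, hg⟩ : ∃ g, h = PowerSeries.X ^ n * g +
        (PowerSeries.trunc n h : PowerSeries (LocalInt v)) :=
      ⟨_, PowerSeries.eq_X_pow_mul_shift_add_trunc n h⟩
    have h1 : seriesEval z (compHom P h0 h) - seriesEval w h =
        w.1 ^ n * (seriesEval z (compHom P h0 g) - seriesEval w g) := by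
      rw [hg]
      simp only [map_add, map_mul, map_pow, compHom_X, seriesEval_X, hpoly, seriesEval_coe,
        ← hw]
      ring
    rw [h1, norm_mul, norm_pow]
    refine mul_le_of_le_one_right (by positivity) ?_
    rw [sub_eq_add_neg]
    refine (IsUltrametricDist.norm_add_le_max _ _).trans (max_le (norm_seriesEval_le_one _ _) ?_)
    rw [norm_neg]
    exact norm_seriesEval_le_one _ _
  have hlim : Tendsto (fun n : ℕ => ‖w.1‖ ^ n) atTop (𝓝 0) :=
    tendsto_pow_atTop_nhds_zero_of_lt_one (norm_nonneg _) w.2.2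
  exact sub_eq_zero.mp (norm_le_zero_iff.mp (ge_of_tendsto' hlim hbound))

end Evaluation

section ProductFormula

variable {k : Type*} [Field k] [Fintype k] {v : HeightOneSpectrum k[X]} {π : k[X]} {p e : ℕ}
  [Fact p.Prime] {P : (LocalInt v)[X]} {W : Finset (Cp v)}

namespace IsTorsionPolynomial

variable (hπ : v.asIdeal = Ideal.span {π}) (hP : IsTorsionPolynomial π p e P W)
include hπ hP

theorem add_mem_puncturedBall {z : Cp v} (hz : ‖z‖ < 1) (hzW : z ∉ W) {u : Cp v} (hu : u ∈ W) :
    0 < ‖z + u‖ ∧ ‖z + u‖ < 1 := by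
  refine ⟨norm_pos_iff.mpr fun h => hzW ?_,
    (IsUltrametricDist.norm_add_le_max _ _).trans_lt (max_lt hz (hP.norm_lt_one_of_mem hπ hu))⟩
  rw [eq_neg_of_add_eq_zero_left h]
  exact hP.neg_mem hu

theorem eval_mem_puncturedBall {z : Cp v} (hz : ‖z‖ < 1) (hzW : z ∉ W) :
    0 < ‖P.eval₂ (embInt v) z‖ ∧ ‖P.eval₂ (embInt v) z‖ < 1 :=
  ⟨norm_pos_iff.mpr fun h => hzW ((hP.eval_eq_zero_iff z).mp h), hP.norm_eval_lt_one hπ hz⟩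

/-- At a point `w = P z` the matrix of multiplication by `f` is diagonalized by the Vandermonde
matrix of the points `z + u` of the fibre, with the values of `f` as eigenvalues. -/
theorem prod_seriesEval [IsAdicComplete (IsLocalRing.maximalIdeal (LocalInt v)) (LocalInt v)]
    (f : PowerSeries (LocalInt v)) {z : Cp v} (hz : ‖z‖ < 1) (hzW : z ∉ W) :
    ∏ u : W, seriesEval ⟨z + u.1, hP.add_mem_puncturedBall hπ hz hzW u.2⟩ f =
      seriesEval ⟨P.eval₂ (embInt v) z, hP.eval_mem_puncturedBall hπ hz hzW⟩
        (seriesNorm hP.distinguished hP.coeff_zero f) := by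
  set w : PuncturedBall v := ⟨P.eval₂ (embInt v) z, hP.eval_mem_puncturedBall hπ hz hzW⟩
  have hcard : W.card = P.natDegree := by rw [hP.card_eq, hP.natDegree_eq]
  let σ : W ≃ Fin P.natDegree := W.equivFinOfCardEq hcard
  let y : Fin P.natDegree → PuncturedBall v := fun i =>
    ⟨z + (σ.symm i : Cp v), hP.add_mem_puncturedBall hπ hz hzW (σ.symm i).2⟩
  have hyw : ∀ i, w.1 = P.eval₂ (embInt v) (y i).1 := fun i =>
    (hP.eval_add_of_mem z (σ.symm i).2).symm
  let V : Matrix (Fin P.natDegree) (Fin P.natDegree) (Cp v) := Matrix.vandermonde fun i => (y i).1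
  let M := (mulMatrix hP.distinguished hP.coeff_zero f).map (seriesEval w)
  have hVM : V * M = Matrix.diagonal (fun i => seriesEval (y i) f) * V := by
    ext i j
    rw [Matrix.mul_apply, Matrix.diagonal_mul]
    have h := congrArg (seriesEval (y i))
      (sum_compHom_mulMatrix hP.distinguished hP.coeff_zero f j)
    rw [map_sum, map_mul, map_pow, seriesEval_X] at h
    have hVij : ∀ l, V i l = (y i).1 ^ (l : ℕ) := fun l => Matrix.vandermonde_apply _ i l
    rw [hVij, ← h]
    refine Finset.sum_congr rfl fun l _ => ?_
    rw [map_mul, map_pow, seriesEval_X, seriesEval_compHom hP.coeff_zero (hyw i), mul_comm,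
      hVij]
    rfl
  have hV : V.det ≠ 0 := by
    refine Matrix.det_vandermonde_ne_zero_iff.mpr fun i j hij => ?_
    exact σ.symm.injective (Subtype.ext (add_left_cancel hij))
  have hdet := congrArg Matrix.det hVM
  rw [Matrix.det_mul, Matrix.det_mul, mul_comm, Matrix.det_diagonal] at hdet
  have hM : M.det = seriesEval w (seriesNorm hP.distinguished hP.coeff_zero f) :=
    (RingHom.map_det (seriesEval w) _).symm
  rw [← hM, mul_right_cancel₀ hV hdet]
  exact Fintype.prod_equiv σ _ _ fun u => by simp [y]

end IsTorsionPolynomial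

end ProductFormula

/-! ### The structure of the unit groups -/

section Gauss

theorem exists_first_max_norm {E : Type*} [NormedAddCommGroup E] {a : ℕ → E}
    (ha : Tendsto a atTop (𝓝 0)) (h0 : a 0 ≠ 0) :
    ∃ i, (∀ n, ‖a n‖ ≤ ‖a i‖) ∧ ∀ n < i, ‖a n‖ < ‖a i‖ := by
  classical
  have hex : ∃ i, ∀ n, ‖a n‖ ≤ ‖a i‖ := by
    obtain ⟨N, hN⟩ := (Metric.tendsto_atTop.mp ha) ‖a 0‖ (norm_pos_iff.mpr h0)
    obtain ⟨i, -, hi⟩ := (Finset.range (N + 1)).exists_max_image (fun n => ‖a n‖) ⟨0, by simp⟩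
    refine ⟨i, fun n => ?_⟩
    by_cases hn : n < N + 1
    · exact hi n (by simpa using hn)
    · have := hN n (by omega)
      rw [dist_zero_right] at this
      exact this.le.trans (hi 0 (by simp))
  refine ⟨Nat.find hex, Nat.find_spec hex, fun n hn => ?_⟩
  by_contra hlt
  exact Nat.find_min hex hn fun m => (Nat.find_spec hex m).trans (not_lt.mp hlt)

/-- Gauss's lemma on the closed unit disc: a power series whose inverse converges there as well
is dominated by its constant coefficient. -/
theorem norm_coeff_le_of_mul_eq_one {E : Type*} [NormedField E] [IsUltrametricDist E]
    {α β : PowerSeries E} (h : α * β = 1)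
    (hα : Tendsto (fun n => PowerSeries.coeff n α) atTop (𝓝 0))
    (hβ : Tendsto (fun n => PowerSeries.coeff n β) atTop (𝓝 0)) (n : ℕ) :
    ‖PowerSeries.coeff n α‖ ≤ ‖PowerSeries.coeff 0 α‖ := by
  have h00 : PowerSeries.coeff 0 α * PowerSeries.coeff 0 β = 1 := by
    have := congrArg (PowerSeries.coeff 0) h
    simpa using this
  obtain ⟨i, hi, hi'⟩ := exists_first_max_norm hα (left_ne_zero_of_mul_eq_one h00)
  obtain ⟨j, hj, hj'⟩ := exists_first_max_norm hβ (right_ne_zero_of_mul_eq_one h00)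
  have hpi : 0 < ‖PowerSeries.coeff i α‖ :=
    (norm_pos_iff.mpr (left_ne_zero_of_mul_eq_one h00)).trans_le (hi 0)
  have hpj : 0 < ‖PowerSeries.coeff j β‖ :=
    (norm_pos_iff.mpr (right_ne_zero_of_mul_eq_one h00)).trans_le (hj 0)
  -- in the coefficient of index `i + j` the term `(i, j)` dominates strictly
  have hrest : ‖∑ x ∈ (Finset.HasAntidiagonal.antidiagonal (i + j)).erase (i, j),
      PowerSeries.coeff x.1 α * PowerSeries.coeff x.2 β‖ <
      ‖PowerSeries.coeff i α * PowerSeries.coeff j β‖ := by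
    rw [norm_mul]
    refine Finset.sum_induction _ (fun y => ‖y‖ < ‖PowerSeries.coeff i α‖ *
      ‖PowerSeries.coeff j β‖) (fun a b ha hb =>
        (IsUltrametricDist.norm_add_le_max a b).trans_lt (max_lt ha hb)) ?_ fun x hx => ?_
    · rw [norm_zero]
      positivity
    · rw [Finset.mem_erase, Finset.HasAntidiagonal.mem_antidiagonal] at hx
      rw [norm_mul]
      rcases lt_or_ge x.1 i with hlt | hge
      · exact (mul_le_mul_of_nonneg_left (hj _) (norm_nonneg _)).trans_lt
          (mul_lt_mul_of_pos_right (hi' _ hlt) hpj)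
      · have hlt : x.2 < j := by
          by_contra hge'
          exact hx.1 (Prod.ext (by omega) (by omega))
        exact mul_lt_mul' (hi _) (hj' _ hlt) (norm_nonneg _) hpi
  have hcoeff : PowerSeries.coeff (i + j) (1 : PowerSeries E) ≠ 0 := by
    rw [← h, PowerSeries.coeff_mul, ← Finset.add_sum_erase _ _
      (Finset.HasAntidiagonal.mem_antidiagonal.mpr rfl :
        (i, j) ∈ Finset.HasAntidiagonal.antidiagonal (i + j)), ← norm_pos_iff,
      IsUltrametricDist.norm_add_eq_max_of_norm_ne_norm hrest.ne', max_eq_left hrest.le, norm_mul]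
    positivity
  have hij : i = 0 := by
    by_contra hne
    exact hcoeff (by rw [PowerSeries.coeff_one, if_neg (by omega)])
  rw [← hij]
  exact hi n

end Gauss

section Units

variable {k : Type*} [Field k] [Fintype k] {v : HeightOneSpectrum k[X]} {R : Subring (Cp v)}

/-- There are points of `𝐂_𝔭` with norm arbitrarily close to `1`. -/
theorem exists_pow_eq_uniformizer {π : k[X]} (hπ : v.asIdeal = Ideal.span {π}) {N : ℕ}
    (hN : 0 < N) : ∃ z : PuncturedBall v, ‖z.1‖ ^ N = ‖embInt v (uniformizer v π)‖ := by
  obtain ⟨y, hy⟩ := IsAlgClosed.exists_pow_nat_eq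
    (algebraMap (LocalField v) (LocalAlgCl v) (uniformizer v π : LocalField v)) hN
  have h : algebraMap (LocalAlgCl v) (Cp v) y ^ N = embInt v (uniformizer v π) := by
    rw [← map_pow, hy]
    rfl
  have h1 : ‖algebraMap (LocalAlgCl v) (Cp v) y‖ ^ N = ‖embInt v (uniformizer v π)‖ := by
    rw [← norm_pow, h]
  refine ⟨⟨algebraMap (LocalAlgCl v) (Cp v) y, ?_, ?_⟩, h1⟩
  · rw [norm_pos_iff]
    intro h0
    rw [h0, zero_pow hN.ne'] at h
    exact uniformizer_ne_zero hπ (embInt_injective (by rw [← h, map_zero]))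
  · by_contra hge
    have h2 := one_le_pow₀ (not_lt.mp hge) (n := N)
    rw [h1] at h2
    exact absurd (norm_uniformizer_lt_one hπ) (not_lt.mpr h2)

theorem le_of_forall_mul_pow_norm_le {π : k[X]} (hπ : v.asIdeal = Ideal.span {π}) {a b : ℝ}
    (hb : 0 < b) {n : ℕ} (h : ∀ z : PuncturedBall v, a * ‖z.1‖ ^ n ≤ b) : a ≤ b := by
  by_contra hlt
  set c := ‖embInt v (uniformizer v π)‖
  have hc : 0 < c :=
    norm_pos_iff.mpr ((map_ne_zero_iff _ embInt_injective).mpr (uniformizer_ne_zero hπ))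
  have hab : 1 < a / b := (one_lt_div hb).mpr (not_le.mp hlt)
  obtain ⟨N, hN⟩ := pow_unbounded_of_one_lt (1 / c ^ n) hab
  obtain ⟨z, hz⟩ := exists_pow_eq_uniformizer hπ (N := N + 1) N.succ_pos
  have h1 : a / b * ‖z.1‖ ^ n ≤ 1 := by
    rw [div_mul_eq_mul_div]
    exact div_le_one_of_le₀ (h z) hb.le
  have h2 := pow_le_one₀ (n := N + 1) (by positivity) h1
  rw [mul_pow, ← pow_mul, mul_comm n, pow_mul, hz] at h2
  have h3 : 1 / c ^ n < (a / b) ^ (N + 1) :=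
    hN.trans (pow_lt_pow_right₀ hab N.lt_succ_self)
  rw [div_lt_iff₀ (by positivity)] at h3
  exact absurd h2 (not_le.mpr h3)

theorem tendsto_coeff_rescale {α : PowerSeries (Cp v)} {m : ℤ} {f : ConvergentLaurent R}
    (hf : f.1 = HahnSeries.single m 1 * HahnSeries.ofPowerSeries ℤ (Cp v) α)
    (z : PuncturedBall v) :
    Tendsto (fun n => PowerSeries.coeff n (PowerSeries.rescale z.1 α)) atTop (𝓝 0) := by
  have h1 := (f.summable z).tendsto_cofinite_zero
  have hinj : Function.Injective fun n : ℕ => m + (n : ℤ) := fun a b h => by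
    simpa using h
  have h2 := (h1.comp hinj.tendsto_cofinite).const_mul (z.1 ^ (-m))
  rw [mul_zero, Nat.cofinite_eq_atTop] at h2
  refine h2.congr fun n => ?_
  have h3 : f.1.coeff (m + n) = PowerSeries.coeff n α := by
    rw [hf, add_comm, HahnSeries.coeff_single_mul_add, one_mul, PowerSeries.coeff_coe]
    simp
  simp only [Function.comp_apply]
  rw [h3, PowerSeries.coeff_rescale, zpow_add₀ z.ne_zero, zpow_neg, zpow_natCast]
  have := zpow_ne_zero m z.ne_zero
  field_simp

/-- A unit of `R((x))₁` is `x ^ m` times a power series dominated by its constant coefficient. -/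
theorem exists_eq_single_mul_of_unit {π : k[X]} (hπ : v.asIdeal = Ideal.span {π})
    (g : (ConvergentLaurent R)ˣ) :
    ∃ (m : ℤ) (α : PowerSeries (Cp v)),
      g.val.1 = HahnSeries.single m 1 * HahnSeries.ofPowerSeries ℤ (Cp v) α ∧
      (∀ n, PowerSeries.coeff n α ∈ R) ∧ (∀ n, ‖PowerSeries.coeff n α‖ ≤ ‖PowerSeries.coeff 0 α‖) ∧
      ∃ b ∈ R, PowerSeries.coeff 0 α * b = 1 := by
  have hmul : g.val.1 * g⁻¹.val.1 = 1 := congrArg Subtype.val g.mul_inv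
  have hg : g.val.1 ≠ 0 := left_ne_zero_of_mul_eq_one hmul
  have hg' : g⁻¹.val.1 ≠ 0 := right_ne_zero_of_mul_eq_one hmul
  set m := g.val.1.order with hm
  have hm' : g⁻¹.val.1.order = -m := by
    have := HahnSeries.order_mul hg hg'
    rw [hmul, HahnSeries.order_one] at this
    omega
  set α := g.val.1.powerSeriesPart with hαdef
  set β := g⁻¹.val.1.powerSeriesPart with hβdef
  have hα : g.val.1 = HahnSeries.single m 1 * HahnSeries.ofPowerSeries ℤ (Cp v) α :=
    (LaurentSeries.single_order_mul_powerSeriesPart _).symm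
  have hβ : g⁻¹.val.1 = HahnSeries.single (-m) 1 * HahnSeries.ofPowerSeries ℤ (Cp v) β := by
    rw [← hm']
    exact (LaurentSeries.single_order_mul_powerSeriesPart _).symm
  have hαβ : α * β = 1 := by
    refine HahnSeries.ofPowerSeries_injective (Γ := ℤ) ?_
    rw [map_mul, map_one, ← hmul, hα, hβ, mul_mul_mul_comm, HahnSeries.single_mul_single,
      add_neg_cancel, mul_one, HahnSeries.single_zero_one, one_mul]
  have h00 : PowerSeries.coeff 0 α * PowerSeries.coeff 0 β = 1 := by
    have := congrArg (PowerSeries.coeff 0) hαβ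
    simpa using this
  refine ⟨m, α, hα, fun n => ?_, fun n => ?_, PowerSeries.coeff 0 β, ?_, h00⟩
  · rw [hαdef, LaurentSeries.powerSeriesPart_coeff]
    exact g.val.2.1 _
  · refine le_of_forall_mul_pow_norm_le hπ
      (norm_pos_iff.mpr (left_ne_zero_of_mul_eq_one h00)) (n := n) fun z => ?_
    have h1 : PowerSeries.rescale z.1 α * PowerSeries.rescale z.1 β = 1 := by
      rw [← map_mul, hαβ, map_one]
    have h2 := norm_coeff_le_of_mul_eq_one h1 (tendsto_coeff_rescale hα z)
      (tendsto_coeff_rescale hβ z) n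
    rw [PowerSeries.coeff_rescale, PowerSeries.coeff_rescale, pow_zero, one_mul, norm_mul,
      norm_pow, mul_comm] at h2
    exact h2
  · rw [hβdef, LaurentSeries.powerSeriesPart_coeff]
    exact g⁻¹.val.2.1 _

theorem convergesOnBall_single (m : ℤ) (c : Cp v) :
    ConvergesOnBall (HahnSeries.single m c : LaurentSeries (Cp v)) := by
  intro z _ _
  refine summable_of_ne_finset_zero (s := {m}) fun n hn => ?_
  rw [HahnSeries.coeff_single_of_ne (by simpa using hn), zero_mul]

/-- The monomial `c x ^ m` in `R((x))₁`. -/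
noncomputable def laurentMonomial (m : ℤ) (c : R) : ConvergentLaurent R :=
  ⟨HahnSeries.single m (c : Cp v), fun n => by
    by_cases h : n = m
    · rw [h, HahnSeries.coeff_single_same]
      exact c.2
    · rw [HahnSeries.coeff_single_of_ne h]
      exact R.zero_mem, convergesOnBall_single m _⟩

theorem laurentMonomial_mul (m n : ℤ) (c d : R) :
    laurentMonomial m c * laurentMonomial n d = laurentMonomial (m + n) (c * d) :=
  Subtype.ext HahnSeries.single_mul_single

theorem laurentMonomial_zero_one : laurentMonomial 0 (1 : R) = 1 := rfl

theorem evalHom_laurentMonomial (z : PuncturedBall v) (m : ℤ) (c : R) :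
    evalHom R z (laurentMonomial m c) = c * z.1 ^ m := by
  change ∑' n : ℤ, (HahnSeries.single m (c : Cp v)).coeff n * z.1 ^ n = _
  rw [tsum_eq_single m, HahnSeries.coeff_single_same]
  intro n hn
  rw [HahnSeries.coeff_single_of_ne hn, zero_mul]

/-- The homomorphism `m ↦ x ^ m` to the units of `R((x))₁`. -/
noncomputable def varPow (R : Subring (Cp v)) : Multiplicative ℤ →* (ConvergentLaurent R)ˣ :=
  MonoidHom.toHomUnits
    { toFun := fun m => laurentMonomial m.toAdd 1
      map_one' := laurentMonomial_zero_one
      map_mul' := fun m n => by rw [laurentMonomial_mul, mul_one, toAdd_mul] }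

/-- The constants `Kˣ` in the units of `K((x))₁`. -/
noncomputable def constUnit (v : HeightOneSpectrum k[X]) :
    (LocalField v)ˣ →* (ConvergentLaurent (subK v))ˣ :=
  Units.map
    { toFun := fun c => laurentMonomial 0 ⟨embField v c, c, rfl⟩
      map_one' := by
        refine Subtype.ext ?_
        change HahnSeries.single 0 (embField v 1) = 1
        rw [map_one]
        rfl
      map_mul' := fun c d => by
        rw [laurentMonomial_mul, add_zero]
        congr 1
        exact Subtype.ext (map_mul _ _ _) }

theorem val_constUnit (c : (LocalField v)ˣ) :
    (constUnit v c).val = laurentMonomial 0 (⟨embField v c, c, rfl⟩ : subK v) := rfl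

/-- The homomorphism `(m, h) ↦ x ^ m h` to the units of `𝒪((x))₁`. -/
noncomputable def unitOfPair (v : HeightOneSpectrum k[X]) :
    Multiplicative ℤ × (PowerSeries (LocalInt v))ˣ →* (ConvergentLaurent (subO v))ˣ :=
  (varPow (subO v)).coprod (Units.map (seriesHom v : PowerSeries (LocalInt v) →* _))

theorem evalHom_unitOfPair (z : PuncturedBall v)
    (x : Multiplicative ℤ × (PowerSeries (LocalInt v))ˣ) :
    evalHom (subO v) z (unitOfPair v x) = z.1 ^ x.1.toAdd * seriesEval z x.2 := by
  have : (unitOfPair v x).val = laurentMonomial x.1.toAdd 1 * seriesHom v x.2 := rfl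
  rw [this, map_mul, evalHom_laurentMonomial]
  simp [seriesEval]

theorem norm_evalHom_unitOfPair (z : PuncturedBall v)
    (x : Multiplicative ℤ × (PowerSeries (LocalInt v))ˣ) :
    ‖evalHom (subO v) z (unitOfPair v x)‖ = ‖z.1‖ ^ x.1.toAdd := by
  rw [evalHom_unitOfPair, norm_mul, norm_seriesEval_unit, mul_one, norm_zpow]

/-- The homomorphism `(c, m, h) ↦ c x ^ m h` to the units of `K((x))₁`. -/
noncomputable def unitOfTriple (v : HeightOneSpectrum k[X]) :
    (LocalField v)ˣ × (Multiplicative ℤ × (PowerSeries (LocalInt v))ˣ) →*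
      (ConvergentLaurent (subK v))ˣ :=
  (constUnit v).coprod ((Units.map (inclOK v : _ →* ConvergentLaurent (subK v))).comp
    (unitOfPair v))

theorem evalHom_unitOfTriple (z : PuncturedBall v)
    (x : (LocalField v)ˣ × (Multiplicative ℤ × (PowerSeries (LocalInt v))ˣ)) :
    evalHom (subK v) z (unitOfTriple v x) =
      embField v x.1 * (z.1 ^ x.2.1.toAdd * seriesEval z x.2.2) := by
  have : (unitOfTriple v x).val = (constUnit v x.1).val * inclOK v (unitOfPair v x.2).val := rfl
  rw [this, map_mul, evalHom_inclOK, evalHom_unitOfPair, val_constUnit, evalHom_laurentMonomial]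
  simp

theorem norm_evalHom_unitOfTriple (z : PuncturedBall v)
    (x : (LocalField v)ˣ × (Multiplicative ℤ × (PowerSeries (LocalInt v))ˣ)) :
    ‖evalHom (subK v) z (unitOfTriple v x)‖ = ‖embField v x.1‖ * ‖z.1‖ ^ x.2.1.toAdd := by
  rw [evalHom_unitOfTriple, norm_mul, norm_mul, norm_seriesEval_unit, mul_one, norm_zpow]

theorem exists_unitOfPair_eq {π : k[X]} (hπ : v.asIdeal = Ideal.span {π})
    (g : (ConvergentLaurent (subO v))ˣ) : ∃ x, unitOfPair v x = g := by
  obtain ⟨m, α, hg, hαR, -, b, hb, hab⟩ := exists_eq_single_mul_of_unit hπ g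
  choose a ha using hαR
  obtain ⟨b, rfl⟩ := hb
  have hunit : IsUnit (PowerSeries.mk a) := by
    rw [PowerSeries.isUnit_iff_constantCoeff]
    refine IsUnit.of_mul_eq_one b (embInt_injective ?_)
    rw [map_mul, map_one, ← hab, ← ha 0]
    simp
  refine ⟨(Multiplicative.ofAdd m, hunit.unit), Units.ext (Subtype.ext ?_)⟩
  change HahnSeries.single m _ * HahnSeries.ofPowerSeries ℤ (Cp v)
    (PowerSeries.map (embInt v) (PowerSeries.mk a)) = g.val.1
  rw [hg]
  congr 2
  ext n
  simp [ha]

theorem surjective_unitOfTriple {π : k[X]} (hπ : v.asIdeal = Ideal.span {π}) :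
    Function.Surjective (unitOfTriple v) := by
  intro g
  obtain ⟨m, α, hg, hαR, hle, b, hb, hab⟩ := exists_eq_single_mul_of_unit hπ g
  choose a ha using hαR
  have ha0 : a 0 ≠ 0 := by
    intro h
    rw [← ha 0, h, map_zero, zero_mul] at hab
    exact zero_ne_one hab
  have hdiv : ∀ n, ∃ c : LocalInt v, embInt v c = embField v (a n / a 0) := fun n => by
    refine exists_embInt_eq ?_
    rw [map_div₀, norm_div, ha, ha]
    exact div_le_one_of_le₀ (hle n) (norm_nonneg _)
  choose c hc using hdiv
  have hc0 : c 0 = 1 := embInt_injective (by rw [hc, div_self ha0, map_one, map_one])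
  have hunit : IsUnit (PowerSeries.mk c) := by
    rw [PowerSeries.isUnit_iff_constantCoeff]
    simp [hc0]
  refine ⟨(Units.mk0 (a 0) ha0, Multiplicative.ofAdd m, hunit.unit), Units.ext (Subtype.ext ?_)⟩
  change HahnSeries.single 0 (embField v (a 0)) * (HahnSeries.single m 1 *
    HahnSeries.ofPowerSeries ℤ (Cp v) (PowerSeries.map (embInt v) (PowerSeries.mk c))) = g.val.1
  have hα : α = PowerSeries.C (embField v (a 0)) *
      PowerSeries.map (embInt v) (PowerSeries.mk c) := by
    ext n
    rw [PowerSeries.coeff_C_mul, PowerSeries.coeff_map, PowerSeries.coeff_mk, hc, map_div₀,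
      ← ha n, mul_div_cancel₀ _ ((_root_.map_ne_zero _).mpr ha0)]
  rw [hg, hα, map_mul, HahnSeries.ofPowerSeries_C, ← mul_assoc, ← mul_assoc, mul_comm]
  rw [mul_comm _ (HahnSeries.C _), mul_comm (HahnSeries.ofPowerSeries ℤ (Cp v) _)]
  rfl

/-- A monomial that is a constant multiple of a power series without zeros is constant. -/
theorem eq_zero_of_forall_norm_zpow {π : k[X]} (hπ : v.asIdeal = Ideal.span {π}) {a : ℝ} {m : ℤ}
    (h : ∀ z : PuncturedBall v, a * ‖z.1‖ ^ m = 1) : a = 1 ∧ m = 0 := by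
  obtain ⟨z, -⟩ := exists_pow_eq_uniformizer hπ one_pos
  have h1 := h z
  have h2 := h ⟨z.1 ^ 2, by rw [norm_pow]; exact pow_pos z.2.1 2, by
    rw [norm_pow]; exact pow_lt_one₀ (norm_nonneg _) z.2.2 two_ne_zero⟩
  have h3 : ‖z.1‖ ^ m = 1 := by
    rw [norm_pow, pow_two, mul_zpow, ← mul_assoc, h1, one_mul] at h2
    exact h2
  refine ⟨by rwa [h3, mul_one] at h1, ?_⟩
  exact (zpow_eq_one_iff_right₀ (norm_nonneg _) z.2.2.ne).mp h3

theorem injective_unitOfPair {π : k[X]} (hπ : v.asIdeal = Ideal.span {π}) :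
    Function.Injective (unitOfPair v) := by
  rw [injective_iff_map_eq_one]
  rintro ⟨m, h⟩ hx
  have hm : m.toAdd = 0 := (eq_zero_of_forall_norm_zpow hπ (a := 1) fun z => by
    rw [one_mul, ← norm_evalHom_unitOfPair z (m, h), hx, Units.val_one, map_one, norm_one]).2
  obtain rfl : m = 1 := hm
  have h1 : seriesHom v h = seriesHom v 1 := by
    rw [map_one]
    have := congrArg Units.val hx
    simpa [unitOfPair] using this
  exact Prod.ext rfl (Units.ext (seriesHom_injective h1))

/-- The units of `𝒪((x))₁` are the series `x ^ m h` with `h` a unit of `𝒪⟦x⟧`. -/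
noncomputable def unitsEquiv {π : k[X]} (hπ : v.asIdeal = Ideal.span {π}) :
    Multiplicative ℤ × (PowerSeries (LocalInt v))ˣ ≃* (ConvergentLaurent (subO v))ˣ :=
  MulEquiv.ofBijective (unitOfPair v) ⟨injective_unitOfPair hπ, exists_unitOfPair_eq hπ⟩

/-- The decomposition `c x ^ m h` is unique up to exchanging a constant unit between `c`
and `h`. -/
theorem exists_of_unitOfTriple_eq_one {π : k[X]} (hπ : v.asIdeal = Ideal.span {π})
    {x : (LocalField v)ˣ × (Multiplicative ℤ × (PowerSeries (LocalInt v))ˣ)}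
    (hx : unitOfTriple v x = 1) : x.2.1 = 1 ∧ ∃ a : LocalInt v,
      (x.2.2 : PowerSeries (LocalInt v)) = PowerSeries.C a ∧
      (x.1 : LocalField v) * a = 1 := by
  obtain ⟨c, m, h⟩ := x
  obtain ⟨hc, hm⟩ := eq_zero_of_forall_norm_zpow hπ (a := ‖embField v c‖) (m := m.toAdd)
    fun z => by
      rw [← norm_evalHom_unitOfTriple z (c, m, h), hx, Units.val_one, map_one, norm_one]
  obtain ⟨a, ha⟩ := exists_embInt_eq (x := (c⁻¹ : (LocalField v)ˣ).val) (by
    rw [Units.val_inv_eq_inv_val, map_inv₀, norm_inv, hc, inv_one])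
  have hca : (c : LocalField v) * a = 1 := by
    have : (a : LocalField v) = (c⁻¹ : (LocalField v)ˣ).val := (embField v).injective ha
    rw [this, Units.mul_inv]
  obtain rfl : m = 1 := hm
  refine ⟨rfl, a, seriesHom_injective (inclOK_injective ?_), hca⟩
  have h1 : (constUnit v c).val * inclOK v (unitOfPair v (1, h)).val = 1 := congrArg Units.val hx
  have h2 : (unitOfPair v (1, h)).val = seriesHom v h := by simp [unitOfPair]
  have h3 : (constUnit v c).val * inclOK v (seriesHom v (PowerSeries.C a)) = 1 := by
    refine Subtype.ext ?_
    change HahnSeries.single 0 (embField v c) * HahnSeries.ofPowerSeries ℤ (Cp v)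
      (PowerSeries.map (embInt v) (PowerSeries.C a)) = 1
    rw [PowerSeries.map_C, HahnSeries.ofPowerSeries_C, HahnSeries.C_apply,
      HahnSeries.single_mul_single, ha, ← map_mul, Units.mul_inv, map_one, add_zero]
    rfl
  rw [h2] at h1
  exact (constUnit v c).isUnit.mul_left_cancel (h1.trans h3.symm)

end Units

/-! ### Convergence on circles -/

section Topology

variable {k : Type*} [Field k] [Fintype k] {v : HeightOneSpectrum k[X]} {R : Subring (Cp v)}

theorem tendsto_uniformity_convergentLaurent {ι : Type*} {l : Filter ι}
    {F G : ι → ConvergentLaurent R} :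
    Tendsto (fun i => (F i, G i)) l (uniformity (ConvergentLaurent R)) ↔
      ∀ ρ : ℝ, ∀ ε > 0, ∀ᶠ i in l, ∀ z : PuncturedBall v, ‖z.1‖ = ρ →
        ‖evalHom R z (F i) - evalHom R z (G i)‖ < ε := by
  have h1 : uniformity (ConvergentLaurent R) = Filter.comap
      (fun q : ConvergentLaurent R × ConvergentLaurent R =>
        (UniformOnFun.ofFun (circles v) fun z : PuncturedBall v => q.1.eval z.1,
          UniformOnFun.ofFun (circles v) fun z : PuncturedBall v => q.2.eval z.1))
      (uniformity (UniformOnFun (PuncturedBall v) (Cp v) (circles v))) := rfl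
  rw [h1, tendsto_comap_iff, UniformOnFun.uniformity_eq]
  simp only [tendsto_iInf, tendsto_principal]
  constructor
  · intro h ρ ε hε
    filter_upwards [h {z | ‖z.1‖ = ρ} ⟨ρ, rfl⟩ _ (Metric.dist_mem_uniformity hε)] with i hi z hz
    rw [← dist_eq_norm]
    exact hi z hz
  · rintro h _ ⟨ρ, rfl⟩ V hV
    obtain ⟨ε, hε, hV⟩ := Metric.mem_uniformity_dist.mp hV
    filter_upwards [h ρ ε hε] with i hi z hz
    refine hV ?_
    rw [dist_eq_norm]
    exact hi z hz

/-- Convergence in `R((x))₁` is uniform convergence on each circle. -/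
theorem tendsto_convergentLaurent_iff {ι : Type*} {l : Filter ι} {F : ι → ConvergentLaurent R}
    {f : ConvergentLaurent R} :
    Tendsto F l (𝓝 f) ↔ ∀ ρ : ℝ, ∀ ε > 0, ∀ᶠ i in l, ∀ z : PuncturedBall v, ‖z.1‖ = ρ →
      ‖evalHom R z (F i) - evalHom R z f‖ < ε := by
  rw [Uniform.tendsto_nhds_left, tendsto_uniformity_convergentLaurent]

theorem tendsto_inclOK_iff {ι : Type*} {l : Filter ι} {F : ι → ConvergentLaurent (subO v)}
    {f : ConvergentLaurent (subO v)} :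
    Tendsto (fun i => inclOK v (F i)) l (𝓝 (inclOK v f)) ↔ Tendsto F l (𝓝 f) := by
  rw [tendsto_convergentLaurent_iff, tendsto_convergentLaurent_iff]
  rfl

theorem continuous_inclOK : Continuous (inclOK v) :=
  continuous_iff_continuousAt.mpr fun _ => tendsto_inclOK_iff.mpr tendsto_id

theorem tendsto_units_of_tendsto_val {M ι : Type*} [Monoid M] [TopologicalSpace M] {l : Filter ι}
    {F : ι → Mˣ} {f : Mˣ} (h : Tendsto (fun i => (F i).val) l (𝓝 f.val))
    (h' : Tendsto (fun i => (F i)⁻¹.val) l (𝓝 f⁻¹.val)) : Tendsto F l (𝓝 f) := by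
  rw [Units.isInducing_embedProduct.tendsto_nhds_iff]
  exact h.prodMk_nhds ((MulOpposite.continuous_op.tendsto _).comp h')

theorem continuous_units_inv {M : Type*} [Monoid M] [TopologicalSpace M] :
    Continuous fun u : Mˣ => u⁻¹ :=
  Units.continuous_iff.mpr ⟨Units.continuous_coe_inv, by simpa using! Units.continuous_val⟩

theorem continuous_of_continuous_val {M N : Type*} [Monoid M] [TopologicalSpace M]
    [Monoid N] [TopologicalSpace N] (f : Mˣ →* Nˣ) (h : Continuous fun g => (f g).val) :
    Continuous f :=
  Units.continuous_iff.mpr ⟨h, (h.comp continuous_units_inv).congr fun g => by simp⟩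

/-- The norm of a unit of `K((x))₁` is constant on circles. -/
theorem exists_norm_evalHom_eq {π : k[X]} (hπ : v.asIdeal = Ideal.span {π})
    (g : (ConvergentLaurent (subK v))ˣ) (ρ : ℝ) :
    ∃ C : ℝ, 0 < C ∧ ∀ z : PuncturedBall v, ‖z.1‖ = ρ → ‖evalHom (subK v) z g‖ = C := by
  by_cases hρ : ∃ z₀ : PuncturedBall v, ‖z₀.1‖ = ρ
  · obtain ⟨z₀, hz₀⟩ := hρ
    refine ⟨‖evalHom (subK v) z₀ g‖, norm_pos_iff.mpr (evalHom_unit_ne_zero _ _), fun z hz => ?_⟩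
    obtain ⟨x, rfl⟩ := surjective_unitOfTriple hπ g
    rw [norm_evalHom_unitOfTriple, norm_evalHom_unitOfTriple, hz, hz₀]
  · exact ⟨1, one_pos, fun z hz => absurd ⟨z, hz⟩ hρ⟩

theorem norm_prod_sub_prod_le {E ι : Type*} [NormedField E] [IsUltrametricDist E] {s : Finset ι}
    {a b : ι → E} {δ : ℝ} (hδ : 0 ≤ δ) (hδ1 : δ ≤ 1) (h : ∀ i ∈ s, ‖a i - b i‖ ≤ δ * ‖b i‖) :
    ‖∏ i ∈ s, a i - ∏ i ∈ s, b i‖ ≤ δ * ‖∏ i ∈ s, b i‖ := by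
  classical
  induction s using Finset.induction_on with
  | empty => simpa using hδ
  | insert i s hi ih =>
    rw [Finset.prod_insert hi, Finset.prod_insert hi]
    have h1 := h i (Finset.mem_insert_self i s)
    have h2 := ih fun j hj => h j (Finset.mem_insert_of_mem hj)
    have h3 : ‖a i‖ ≤ ‖b i‖ := by
      rw [← sub_add_cancel (a i) (b i)]
      exact (IsUltrametricDist.norm_add_le_max _ _).trans (max_le
        (h1.trans (mul_le_of_le_one_left (norm_nonneg _) hδ1)) le_rfl)
    have h4 : a i * ∏ j ∈ s, a j - b i * ∏ j ∈ s, b j =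
        a i * (∏ j ∈ s, a j - ∏ j ∈ s, b j) + (a i - b i) * ∏ j ∈ s, b j := by ring
    rw [h4, norm_mul (b i)]
    refine (IsUltrametricDist.norm_add_le_max _ _).trans (max_le ?_ ?_)
    · rw [norm_mul]
      calc _ ≤ ‖b i‖ * (δ * ‖∏ j ∈ s, b j‖) := mul_le_mul h3 h2 (norm_nonneg _) (norm_nonneg _)
        _ = _ := by ring
    · rw [norm_mul]
      calc _ ≤ δ * ‖b i‖ * ‖∏ j ∈ s, b j‖ := mul_le_mul_of_nonneg_right h1 (norm_nonneg _)
        _ = _ := by ring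

end Topology

/-! ### The norm operator and its iterates -/

section NormOperator

variable {k : Type*} [Field k] [Fintype k] {v : HeightOneSpectrum k[X]} {π : k[X]} {p e : ℕ}
  {P : (LocalInt v)[X]} {W : Finset (Cp v)}
  [IsAdicComplete (IsLocalRing.maximalIdeal (LocalInt v)) (LocalInt v)]

namespace IsTorsionPolynomial

/-- The norm operator on triples: `(c, m, h) ↦ (c ^ Q, m, Norm h)`. That the exponent `m` is
preserved reflects that `∏ u, (x + u) = P x`. -/
noncomputable def tripleNorm (hP : IsTorsionPolynomial π p e P W) :
    (LocalField v)ˣ × (Multiplicative ℤ × (PowerSeries (LocalInt v))ˣ) →*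
      (LocalField v)ˣ × (Multiplicative ℤ × (PowerSeries (LocalInt v))ˣ) :=
  (powMonoidHom (p ^ e)).prodMap
    ((MonoidHom.id _).prodMap (unitsNorm hP.distinguished hP.coeff_zero))

variable (hπ : v.asIdeal = Ideal.span {π}) (hP : IsTorsionPolynomial π p e P W)

include hπ in
/-- The norm of triples respects the ambiguity of the decomposition `c x ^ m h`: the norm of a
constant `a` is `a ^ Q`. -/
theorem ker_unitOfTriple_le :
    (unitOfTriple v).ker ≤ ((unitOfTriple v).comp hP.tripleNorm).ker := by
  intro x hx
  rw [MonoidHom.mem_ker] at hx ⊢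
  obtain ⟨c, m, h⟩ := x
  obtain ⟨hm, a, ha, -⟩ := exists_of_unitOfTriple_eq_one hπ hx
  dsimp only at hm ha
  subst hm
  have h1 : (constUnit v c).val * inclOK v (seriesHom v h) = 1 := by
    have := congrArg Units.val hx
    simpa [unitOfTriple, unitOfPair] using this
  have h2 : ((unitOfTriple v).comp hP.tripleNorm (c, 1, h)).val =
      (constUnit v c).val ^ p ^ e *
        inclOK v (seriesHom v (seriesNorm hP.distinguished hP.coeff_zero h)) := by
    simp [unitOfTriple, unitOfPair, tripleNorm, unitsNorm]
  refine Units.ext ?_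
  rw [h2, ha, seriesNorm_C, hP.natDegree_eq, ← ha, map_pow, map_pow, ← mul_pow, h1, one_pow,
    Units.val_one]

/-- The norm operator `c x ^ m h ↦ c ^ Q x ^ m Norm h` on the units of `K((x))₁`. -/
noncomputable def normOperator :
    (ConvergentLaurent (subK v))ˣ →* (ConvergentLaurent (subK v))ˣ :=
  (unitOfTriple v).liftOfSurjective (surjective_unitOfTriple hπ)
    ⟨(unitOfTriple v).comp hP.tripleNorm, hP.ker_unitOfTriple_le hπ⟩

theorem normOperator_unitOfTriple
    (x : (LocalField v)ˣ × (Multiplicative ℤ × (PowerSeries (LocalInt v))ˣ)) :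
    hP.normOperator hπ (unitOfTriple v x) = unitOfTriple v (hP.tripleNorm x) :=
  (unitOfTriple v).liftOfRightInverse_comp_apply _ _
    ⟨(unitOfTriple v).comp hP.tripleNorm, hP.ker_unitOfTriple_le hπ⟩ x

variable [Fact p.Prime]

/-- The product formula that characterizes the norm operator. -/
theorem prod_evalHom (g : (ConvergentLaurent (subK v))ˣ) {z : Cp v} (hz : ‖z‖ < 1)
    (hzW : z ∉ W) :
    ∏ u : W, evalHom (subK v) ⟨z + u.1, hP.add_mem_puncturedBall hπ hz hzW u.2⟩ g =
      evalHom (subK v) ⟨P.eval₂ (embInt v) z, hP.eval_mem_puncturedBall hπ hz hzW⟩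
        (hP.normOperator hπ g) := by
  obtain ⟨⟨c, m, h⟩, rfl⟩ := surjective_unitOfTriple hπ g
  rw [normOperator_unitOfTriple, evalHom_unitOfTriple]
  simp only [evalHom_unitOfTriple]
  rw [Finset.prod_mul_distrib, Finset.prod_mul_distrib, hP.prod_seriesEval hπ _ hz hzW,
    Finset.prod_zpow, Finset.prod_const, Finset.card_univ, Fintype.card_coe, hP.card_eq,
    Finset.prod_coe_sort W (fun u => z + u), ← hP.eval_eq_prod_add]
  simp [tripleNorm, unitsNorm]

/-- The norm operator is continuous: a circle is covered by the images of finitely many circles,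
on which a unit close to `g` is close to `g` in the relative sense, and relative closeness is
inherited by products. -/
theorem continuous_normOperator : Continuous (hP.normOperator hπ) := by
  refine continuous_of_continuous_val _ (continuous_iff_continuousAt.mpr fun g₀ => ?_)
  refine tendsto_convergentLaurent_iff.mpr fun σ ε hε => ?_
  by_cases hσ : 0 < σ
  swap
  · exact Eventually.of_forall fun g z hz => absurd (hz ▸ z.2.1) hσ
  obtain ⟨C, hC, hCeq⟩ := exists_norm_evalHom_eq hπ (hP.normOperator hπ g₀) σ
  set δ := min 1 (ε / (2 * C))
  have hδ : 0 < δ := lt_min one_pos (by positivity)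
  have hδC : δ * C < ε := by
    calc δ * C ≤ ε / (2 * C) * C := mul_le_mul_of_nonneg_right (min_le_right _ _) hC.le
      _ = ε / 2 := by field_simp
      _ < ε := half_lt_self hε
  have hev : ∀ᶠ g : (ConvergentLaurent (subK v))ˣ in 𝓝 g₀,
      ∀ ρ ∈ {ρ : ℝ | ∃ z : Cp v, ‖P.eval₂ (embInt v) z‖ = σ ∧ ‖z‖ = ρ},
      ∀ z : PuncturedBall v, ‖z.1‖ = ρ →
        ‖evalHom (subK v) z g - evalHom (subK v) z g₀‖ ≤ δ * ‖evalHom (subK v) z g₀‖ := by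
    rw [Filter.eventually_all_finite (hP.finite_norms_of_norm_eval_eq hσ)]
    intro ρ _
    obtain ⟨D, hD, hDeq⟩ := exists_norm_evalHom_eq hπ g₀ ρ
    filter_upwards [tendsto_convergentLaurent_iff.mp (Units.continuous_val.tendsto g₀) ρ
      (δ * D) (by positivity)] with g hg z hz
    rw [hDeq z hz]
    exact (hg z hz).le
  filter_upwards [hev] with g hg w hw
  obtain ⟨z, hz⟩ := hP.surjective_eval w.1
  have hz1 : ‖z‖ < 1 := hP.norm_lt_one_of_norm_eval_lt_one hπ (by rw [hz]; exact w.2.2)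
  have hzW : z ∉ W := fun h => w.ne_zero (by rw [← hz, (hP.eval_eq_zero_iff z).mpr h])
  obtain rfl : w = ⟨P.eval₂ (embInt v) z, hP.eval_mem_puncturedBall hπ hz1 hzW⟩ :=
    Subtype.ext hz.symm
  rw [← hP.prod_evalHom hπ g hz1 hzW, ← hP.prod_evalHom hπ g₀ hz1 hzW]
  refine (norm_prod_sub_prod_le hδ.le (min_le_left _ _) fun u _ => ?_).trans_lt ?_
  · refine hg _ ⟨z + u.1, ?_, rfl⟩ _ rfl
    rw [hP.eval_add_of_mem z u.2]
    exact hw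
  · rw [hP.prod_evalHom hπ g₀ hz1 hzW, hCeq _ hw]
    exact hδC

end IsTorsionPolynomial

end NormOperator

/-! ### Iterates of the norm operator on `𝒪((x))₁` -/

section UnitsEndomorphism

variable {k : Type*} [Field k] [Fintype k] {v : HeightOneSpectrum k[X]} {π : k[X]}
  (hπ : v.asIdeal = Ideal.span {π})

/-- The endomorphism of the units of `𝒪((x))₁` given by `x ^ m h ↦ x ^ m (f h)`. -/
noncomputable def conjUnits (f : (PowerSeries (LocalInt v))ˣ →* (PowerSeries (LocalInt v))ˣ) :
    (ConvergentLaurent (subO v))ˣ →* (ConvergentLaurent (subO v))ˣ :=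
  (unitOfPair v).comp (((MonoidHom.id _).prodMap f).comp (unitsEquiv hπ).symm.toMonoidHom)

theorem conjUnits_unitOfPair (f : (PowerSeries (LocalInt v))ˣ →* (PowerSeries (LocalInt v))ˣ)
    (x : Multiplicative ℤ × (PowerSeries (LocalInt v))ˣ) :
    conjUnits hπ f (unitOfPair v x) = unitOfPair v (x.1, f x.2) := by
  have h : (unitsEquiv hπ).symm (unitOfPair v x) = x := (unitsEquiv hπ).symm_apply_apply x
  simp only [conjUnits, MonoidHom.comp_apply, MulEquiv.coe_toMonoidHom, h]
  rfl

theorem iterate_conjUnits_unitOfPair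
    (f : (PowerSeries (LocalInt v))ˣ →* (PowerSeries (LocalInt v))ˣ) (n : ℕ)
    (x : Multiplicative ℤ × (PowerSeries (LocalInt v))ˣ) :
    (conjUnits hπ f)^[n] (unitOfPair v x) = unitOfPair v (x.1, f^[n] x.2) := by
  induction n with
  | zero => rfl
  | succ n ih =>
    rw [Function.iterate_succ_apply', ih, conjUnits_unitOfPair, Function.iterate_succ_apply']

/-- Congruence modulo `ϖ ^ n` of power series, read off as a relative error on the punctured
ball. -/
theorem norm_evalHom_iterate_conjUnits_sub_le
    {f l : (PowerSeries (LocalInt v))ˣ →* (PowerSeries (LocalInt v))ˣ}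
    {ϖ : LocalInt v} {n : ℕ} (h : ∀ g, PowerSeries.C ϖ ^ n ∣
      ((f^[n] g : (PowerSeries (LocalInt v))ˣ) : PowerSeries (LocalInt v)) - l g)
    (z : PuncturedBall v) (g : (ConvergentLaurent (subO v))ˣ) :
    ‖evalHom (subO v) z ((conjUnits hπ f)^[n] g) - evalHom (subO v) z (conjUnits hπ l g)‖ ≤
      ‖evalHom (subO v) z g‖ * ‖embInt v ϖ‖ ^ n := by
  obtain ⟨x, rfl⟩ := exists_unitOfPair_eq hπ g
  obtain ⟨d, hd⟩ := h x.2
  rw [iterate_conjUnits_unitOfPair, conjUnits_unitOfPair, evalHom_unitOfPair, evalHom_unitOfPair,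
    norm_evalHom_unitOfPair, ← mul_sub, ← map_sub, hd, map_mul, map_pow, seriesEval_C, norm_mul,
    norm_mul, norm_pow, norm_zpow]
  exact mul_le_mul_of_nonneg_left
    (mul_le_of_le_one_right (by positivity) (norm_seriesEval_le_one z d)) (by positivity)

/-- Congruences `f^n g ≡ l g` modulo powers of a topologically nilpotent `ϖ` yield locally uniform
convergence on the units of `𝒪((x))₁`, as the absolute value of a unit on a circle is locally
constant. -/
theorem tendstoLocallyUniformly_iterate_conjUnits
    {f l : (PowerSeries (LocalInt v))ˣ →* (PowerSeries (LocalInt v))ˣ}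
    {ϖ : LocalInt v} (hϖ : ‖embInt v ϖ‖ < 1) (h : ∀ g (n : ℕ), PowerSeries.C ϖ ^ n ∣
      ((f^[n] g : (PowerSeries (LocalInt v))ˣ) : PowerSeries (LocalInt v)) - l g) :
    TendstoLocallyUniformly (fun (n : ℕ) g => ((conjUnits hπ f)^[n] g).val)
      (fun g => (conjUnits hπ l g).val) atTop := by
  rw [tendstoLocallyUniformly_iff_forall_tendsto]
  intro g₀
  refine tendsto_uniformity_convergentLaurent.mpr fun ρ ε hε => ?_
  obtain ⟨C, hC, hCeq⟩ := exists_norm_evalHom_eq hπ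
    (Units.map (inclOK v : _ →* ConvergentLaurent (subK v)) g₀) ρ
  have hlim : Tendsto (fun n : ℕ => C * ‖embInt v ϖ‖ ^ n) atTop (𝓝 0) := by
    simpa using (tendsto_pow_atTop_nhds_zero_of_lt_one (norm_nonneg _) hϖ).const_mul C
  have h1 := tendsto_convergentLaurent_iff.mp (Units.continuous_val.tendsto g₀) ρ C hC
  filter_upwards [(hlim.eventually_lt_const hε).prod_mk h1] with ⟨n, g⟩ ⟨hn, hg⟩ z hz
  have h2 : ‖evalHom (subO v) z g₀‖ = C := hCeq z hz
  have h3 : ‖evalHom (subO v) z g‖ ≤ C := by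
    rw [← sub_add_cancel (evalHom (subO v) z g) (evalHom (subO v) z g₀)]
    exact (IsUltrametricDist.norm_add_le_max _ _).trans (max_le (hg z hz).le h2.le)
  rw [norm_sub_rev]
  exact ((norm_evalHom_iterate_conjUnits_sub_le hπ (fun g => h g n) z g).trans
    (mul_le_mul_of_nonneg_right h3 (by positivity))).trans_lt hn

theorem tendsto_iterate_conjUnits
    {f l : (PowerSeries (LocalInt v))ˣ →* (PowerSeries (LocalInt v))ˣ}
    (h : TendstoLocallyUniformly (fun (n : ℕ) g => ((conjUnits hπ f)^[n] g).val)
      (fun g => (conjUnits hπ l g).val) atTop) (g : (ConvergentLaurent (subO v))ˣ) :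
    Tendsto (fun n => (conjUnits hπ f)^[n] g) atTop (𝓝 (conjUnits hπ l g)) := by
  have h1 := fun g => (tendstoLocallyUniformlyOn_univ.mpr h).tendsto_at (Set.mem_univ g)
  refine tendsto_units_of_tendsto_val (h1 g) ?_
  simpa only [iterate_map_inv, map_inv] using h1 g⁻¹

end UnitsEndomorphism

namespace IsTorsionPolynomial

variable {k : Type*} [Field k] [Fintype k] {v : HeightOneSpectrum k[X]} {π : k[X]} {p e : ℕ}
  {P : (LocalInt v)[X]} {W : Finset (Cp v)}
  [IsAdicComplete (IsLocalRing.maximalIdeal (LocalInt v)) (LocalInt v)]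
  (hP : IsTorsionPolynomial π p e P W) (hπ : v.asIdeal = Ideal.span {π})

theorem map_inclOK_conjUnits_unitsNorm (g : (ConvergentLaurent (subO v))ˣ) :
    Units.map (inclOK v : _ →* ConvergentLaurent (subK v))
        (conjUnits hπ (unitsNorm hP.distinguished hP.coeff_zero) g) =
      hP.normOperator hπ (Units.map (inclOK v : _ →* ConvergentLaurent (subK v)) g) := by
  obtain ⟨x, rfl⟩ := exists_unitOfPair_eq hπ g
  have h : ∀ y, Units.map (inclOK v : _ →* ConvergentLaurent (subK v)) (unitOfPair v y) =
      unitOfTriple v (1, y) := fun y => by simp [unitOfTriple]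
  rw [conjUnits_unitOfPair, h, h, normOperator_unitOfTriple]
  exact congrArg (unitOfTriple v) (Prod.ext (one_pow _).symm rfl)

theorem continuous_conjUnits_unitsNorm [Fact p.Prime] :
    Continuous (conjUnits hπ (unitsNorm hP.distinguished hP.coeff_zero)) := by
  refine continuous_of_continuous_val _ (continuous_iff_continuousAt.mpr fun g₀ => ?_)
  refine tendsto_inclOK_iff.mp ?_
  have h := (Units.continuous_val.comp ((hP.continuous_normOperator hπ).comp
    (Continuous.units_map (inclOK v : _ →* ConvergentLaurent (subK v))
      continuous_inclOK))).tendsto g₀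
  simpa only [Function.comp_def, ← hP.map_inclOK_conjUnits_unitsNorm hπ] using! h

end IsTorsionPolynomial

end DrinfeldColeman

open DrinfeldColeman

theorem mainTheorem8 {k : Type*} [Field k] [Fintype k]
    (v : HeightOneSpectrum k[X]) (π : k[X]) (hπ : v.asIdeal = Ideal.span {π})
    (Φ : DrinfeldModule v) (r : ℕ) (hr : 1 < r) (hrank : Φ.HasRank r)
    (hgood : Φ.HasGoodReduction) (hheight : Φ.HasHeight π r) (hmonic : (Φ.poly π).Monic) :
    ∃ N : (ConvergentLaurent (subK v))ˣ →ₜ* (ConvergentLaurent (subK v))ˣ,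
      (∀ (g : (ConvergentLaurent (subK v))ˣ) (z : Cp v), ‖z‖ < 1 → z ∉ Φ.torsion →
        ∏ᶠ u ∈ Φ.torsion, g.val.eval (z + u) = (N g).val.eval (Φ.eval π z)) ∧
      ∃ N₀ : (ConvergentLaurent (subO v))ˣ →* (ConvergentLaurent (subO v))ˣ,
        (∀ g, Units.map (inclOK v) (N₀ g) = N (Units.map (inclOK v) g)) ∧
        ∃ Ninf : (ConvergentLaurent (subO v))ˣ →ₜ* (ConvergentLaurent (subO v))ˣ,
          (∀ g, Tendsto (fun n : ℕ => N₀^[n] g) atTop (𝓝 (Ninf g))) ∧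
          TendstoLocallyUniformly (fun (n : ℕ) g => (N₀^[n] g).val) (fun g => (Ninf g).val)
            atTop := by
  obtain ⟨p, hchar⟩ := CharP.exists k
  have hp : Fact p.Prime := ⟨(CharP.char_is_prime_or_zero k p).resolve_right
    (CharP.char_ne_zero_of_finite k p)⟩
  have hcharO : CharP (LocalInt v) p := charP_localInt p
  have hcomplete := isAdicComplete_localInt hπ
  obtain ⟨e, W, hP, hW⟩ :=
    exists_isTorsionPolynomial hπ Φ (zero_lt_one.trans hr) hrank hheight hmonic p
  obtain ⟨l, hl⟩ := exists_monoidHom_forall_C_pow_dvd_iterate_sub hP.distinguished hP.coeff_zero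
    hP.natDegree_eq (prime_uniformizer hπ) hP.dvd_pow_sub hP.dvd_sub
    (maximalIdeal_eq_span_uniformizer hπ) hP.one_le
  have hlim := tendstoLocallyUniformly_iterate_conjUnits hπ (norm_uniformizer_lt_one hπ) hl
  have hcont : Continuous (conjUnits hπ l) := by
    refine continuous_of_continuous_val _ (hlim.continuous (Frequently.of_forall fun n => ?_))
    exact Units.continuous_val.comp ((hP.continuous_conjUnits_unitsNorm hπ).iterate n)
  refine ⟨⟨hP.normOperator hπ, hP.continuous_normOperator hπ⟩, fun g z hz hzW => ?_, _,
    hP.map_inclOK_conjUnits_unitsNorm hπ, ⟨conjUnits hπ l, hcont⟩,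
    tendsto_iterate_conjUnits hπ hlim, hlim⟩
  rw [hW] at hzW ⊢
  rw [finprod_mem_coe_finset, ← Finset.prod_coe_sort]
  exact hP.prod_evalHom hπ g hz hzW
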